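/- Let $p$ be an odd prime and let $F$ be a totally real number field. For a finite place $v$ of $F$ let $k_v$ be its residue field, $q_v=\#k_v=\mathbf N v$, and fix a uniformiser $\pi_v$ of $F_v$. Let $\mathcal O$ be the ring of integers of $\overline{\mathbb Q}_p$ and $\overline{\mathbb F}_p$ its residue field, and let $\overline\rho:G_F\to\mathrm{GL}_2(\overline{\mathbb F}_p)$ be a continuous representation of the absolute Galois group of $F$. Quaternion algebras and weights. Let $D$ be a quaternion algebra with centre $F$ that is ramified at all infinite places and at a set $\Sigma$ of finite places, $\Sigma$ containing all places above $p$ ($D$ is split at the finite places outside $\Sigma$). Fix a maximal order $\mathcal O_D$ and isomorphisms $\mathcal O_{D,v}\cong M_2(\mathcal O_{F_v})$ for finite $v\notin\Sigma$. A weight for $D$ is a representation $\sigma=\bigotimes_{v\mid p}\sigma_v$ with each $\sigma_v$ an irreducible smooth $\overline{\mathbb F}_p$-representation of $\mathcal O_{D,v}^\times$. Each $\sigma_v$ is one-dimensional, so it is a character $\mathcal O_{D,v}^\times\to\overline{\mathbb F}_p^\times$ with open kernel; it factors through $k_{2,v}^\times$, where the residue field $k_{2,v}$ of $\mathcal O_{D,v}$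 is a quadratic extension of $k_v$. Modular forms. Let $\mathbb A_F^f$ be the ring of finite adeles, and let $U=\prod_vU_v\subset(D\otimes_F\mathbb A_F^f)^\times$ be a compact open subgroup with $U_v\subset\mathcal O_{D,v}^\times$ for all $v$, $U_v=\mathcal O_{D,v}^\times$ for $v\in\Sigma$, and $(U(\mathbb A_F^f)^\times\cap t^{-1}D^\times t)/F^\times=1$ for all $t\in(D\otimes_F\mathbb A_F^f)^\times$. Let $U$ act on the line $W_\sigma$ of $\sigma$ through the projection to $\prod_{v\mid p}U_v$. Let $\psi:F^\times\backslash(\mathbb A_F^f)^\times\to\mathcal O^\times$ be a continuous character such that for every finite place $v$ the group $U_v\cap\mathcal O_{F_v}^\times$ acts on $W_\sigma$ by $\psi^{-1}$. Let $S_{\sigma,\psi}(U,\mathcal O)$ be the $\mathcal O$-module of continuous functions $f:D^\times\backslash(D\otimes_F\mathbb A_F^f)^\times\to W_\sigma$ with $f(gu)=\sigma(u)^{-1}f(g)$ for $u\in U$ and $f(gz)=\psi(z)f(g)$ for $z\in(\mathbb A_F^f)^\times$. Let $S$ be a finite set of finite places that contains $\Sigma$ and all $v$ with $U_v\ne\mathcal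 O_{D,v}^\times$. The ring $\mathbb T=\mathcal O[T_v,S_v]_{v\notin S}$ acts on $S_{\sigma,\psi}(U,\mathcal O)$, with $T_v$ and $S_v$ acting by the double cosets of $\begin{pmatrix}\pi_v&0\\0&1\end{pmatrix}$ and $\begin{pmatrix}\pi_v&0\\0&\pi_v\end{pmatrix}$ (for the right translation action on functions). Modularity. We say that $\overline\rho$ is modular of weight $\sigma$ for $D$ if for some $U,S,\psi$ as above there is a maximal ideal $\mathfrak m$ of $\mathbb T$ with residue field $\overline{\mathbb F}_p$ (as an $\mathcal O$-algebra) such that $S_{\sigma,\psi}(U,\mathcal O)_{\mathfrak m}\neq0$ and $\overline\rho\cong\overline\rho_{\mathfrak m}$; that is, $\overline\rho$ is semisimple, and for all $v\notin S$ it is unramified at $v$ and the characteristic polynomial of $\overline\rho(\mathrm{Frob}_v)$, for an arithmetic Frobenius $\mathrm{Frob}_v$ at $v$, is the image of $X^2-T_vX+S_v\mathbf Nv$ in $\overline{\mathbb F}_p[X]$. To let $D$ vary, fix quadratic extensions $k_{2,v}$ of $k_v$ for all $v\mid p$ and, for each choice of $D$ with its auxiliary data as above, identifications over $k_v$ of the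 residue fields of the rings $\mathcal O_{D,v}$ with $k_{2,v}$. A weight is then a family of characters $\sigma_v:k_{2,v}^\times\to\overline{\mathbb F}_p^\times$, and $\overline\rho$ is modular of weight $\sigma$ if it is so for some $D$. Let $W(\overline\rho)$ be the set of weights of which $\overline\rho$ is modular. Lemma. Let $v$ be a place of $F$ dividing $p$, let $\sigma=\bigotimes_{w\mid p}\sigma_w$ be a weight, and let $\sigma'=\sigma_v^{q_v}\otimes\bigotimes_{w\mid p,\,w\neq v}\sigma_w$. Then $\overline\rho$ is modular of weight $\sigma$ if and only if it is modular of weight $\sigma'$; so replacing $\sigma_v$ by $\sigma_v^{q_v}$ preserves $W(\overline\rho)$. This holds for each fixed $D$, and also for varying $D$, whatever the chosen identifications of residue fields. -/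

import Mathlib

open NumberField IsDedekindDomain TensorProduct
open scoped Classical Polynomial

universe u

set_option linter.unusedSectionVars false

noncomputable section

namespace SerreWeight

/-! ### Coefficients -/

/-- The ring of integers `𝒪` of the algebraic closure of `ℚ_p`, with its `p`-adic topology. -/
abbrev Coeff (p : ℕ) [Fact p.Prime] : ValuationSubring (PadicAlgCl p) :=
  (Valued.v : Valuation (PadicAlgCl p) NNReal).valuationSubring

/-- The residue field of `𝒪`; it is an algebraic closure of `𝔽_p`. -/
abbrev Fbar (p : ℕ) [Fact p.Prime] : Type := IsLocalRing.ResidueField (Coeff p)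

/-- The places of `F` above `p`. -/
abbrev PlacesAbove (F : Type u) [Field F] [NumberField F] (p : ℕ) : Type u :=
  {v : HeightOneSpectrum (𝓞 F) // (p : 𝓞 F) ∈ v.asIdeal}

instance (F : Type u) [Field F] [NumberField F] (p : ℕ) [Fact p.Prime] :
    Finite (PlacesAbove F p) := by
  have hp : (Ideal.span {(p : 𝓞 F)}) ≠ 0 := by
    simpa using (Fact.out : p.Prime).ne_zero
  have := Ideal.finite_factors hp
  refine Set.Finite.to_subtype (this.subset ?_)
  intro v hv
  exact Ideal.dvd_span_singleton.2 hv

instance (F : Type u) [Field F] [NumberField F] (p : ℕ) [Fact p.Prime] :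
    Fintype (PlacesAbove F p) := Fintype.ofFinite _

/-! ### Local and adelic points of an algebra over a number field -/

section Adelic

variable (F : Type u) [Field F] [NumberField F] (D : Type u) [Ring D] [Algebra F D]
  (v : HeightOneSpectrum (𝓞 F))

/-- `D_v = F_v ⊗_F D` for a finite place `v`. -/
abbrev LocalAlg : Type u := v.adicCompletion F ⊗[F] D

/-- `𝔸_F^f ⊗_F D`. -/
abbrev AdelicAlg : Type u := FiniteAdeleRing (𝓞 F) F ⊗[F] D

/-- The usual topology of the `F_v`-vector space `D_v`. -/
instance : TopologicalSpace (LocalAlg F D v) := moduleTopology (v.adicCompletion F) _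

/-- The usual topology of the free `𝔸_F^f`-module `𝔸_F^f ⊗_F D`. -/
instance : TopologicalSpace (AdelicAlg F D) := moduleTopology (FiniteAdeleRing (𝓞 F) F) _

instance : IsModuleTopology (FiniteAdeleRing (𝓞 F) F) (AdelicAlg F D) := ⟨rfl⟩

instance [Module.Finite F D] : IsTopologicalRing (AdelicAlg F D) :=
  IsModuleTopology.isTopologicalRing (FiniteAdeleRing (𝓞 F) F) _

/-- The projection `𝔸_F^f → F_v`. -/
def adeleEval : FiniteAdeleRing (𝓞 F) F →ₐ[F] v.adicCompletion F where
  toFun a := a v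
  map_one' := rfl
  map_mul' _ _ := rfl
  map_zero' := rfl
  map_add' _ _ := rfl
  commutes' _ := rfl

/-- The projection `𝔸_F^f ⊗_F D → D_v`. -/
def comp : AdelicAlg F D →ₐ[F] LocalAlg F D v :=
  Algebra.TensorProduct.map (adeleEval F v) (AlgHom.id F D)

/-- The adele with component `x` at `v` and `0` at all the other places, as a function. -/
def adeleSingleFun (x : v.adicCompletion F) : FiniteAdeleRing (𝓞 F) F :=
  ⟨Pi.single v x, by
    filter_upwards [show {v}ᶜ ∈ Filter.cofinite by simp] with w hw
    rw [Pi.single_eq_of_ne (Set.mem_compl_singleton_iff.1 hw)]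
    exact zero_mem _⟩

/-- The adele with component `x` at `v` and `0` at all the other places. -/
def adeleSingle : v.adicCompletion F →ₗ[F] FiniteAdeleRing (𝓞 F) F where
  toFun x := adeleSingleFun F v x
  map_add' x y := FiniteAdeleRing.ext F fun w =>
    congrFun (Pi.single_add (f := fun v : HeightOneSpectrum (𝓞 F) => v.adicCompletion F) v x y) w
  map_smul' c x := FiniteAdeleRing.ext F fun w => by
    rw [RingHom.id_apply, Algebra.smul_def c x, Algebra.smul_def c (adeleSingleFun F v x)]
    change (Pi.single v _ : ∀ w : HeightOneSpectrum (𝓞 F), w.adicCompletion F) w =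
      algebraMap F (w.adicCompletion F) c *
        (Pi.single v x : ∀ w : HeightOneSpectrum (𝓞 F), w.adicCompletion F) w
    by_cases h : w = v
    · subst h; simp
    · simp [h]

lemma adeleSingle_apply (x : v.adicCompletion F) (w : HeightOneSpectrum (𝓞 F)) :
    adeleSingle F v x w =
      (Pi.single v x : ∀ w : HeightOneSpectrum (𝓞 F), w.adicCompletion F) w := rfl

lemma adeleSingle_mul (a : FiniteAdeleRing (𝓞 F) F) (x : v.adicCompletion F) :
    a * adeleSingle F v x = adeleSingle F v (a v * x) :=
  FiniteAdeleRing.ext F fun w => by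
    change a w * adeleSingle F v x w = _
    rw [adeleSingle_apply, adeleSingle_apply]
    by_cases h : w = v
    · subst h; simp
    · simp [h]

lemma adeleEval_single_same (x : v.adicCompletion F) :
    adeleEval F v (adeleSingle F v x) = x := by
  change adeleSingle F v x v = x
  rw [adeleSingle_apply, Pi.single_eq_same]

lemma adeleEval_single_ne {w : HeightOneSpectrum (𝓞 F)} (h : w ≠ v) (x : v.adicCompletion F) :
    adeleEval F w (adeleSingle F v x) = 0 := by
  change adeleSingle F v x w = 0
  rw [adeleSingle_apply, Pi.single_eq_of_ne h]

/-- The element with component `x` at `v` and `0` at all the other places. -/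
def extZero : LocalAlg F D v →ₗ[F] AdelicAlg F D := (adeleSingle F v).rTensor D

variable {D}

lemma mul_extZero (y : AdelicAlg F D) (x : LocalAlg F D v) :
    y * extZero F D v x = extZero F D v (comp F D v y * x) := by
  induction y using TensorProduct.induction_on with
  | zero => simp
  | add a b ha hb => simp [add_mul, ha, hb]
  | tmul a d =>
    induction x using TensorProduct.induction_on with
    | zero => simp
    | add a b ha hb => simp [mul_add, ha, hb]
    | tmul b e =>
      simp only [extZero, comp, LinearMap.rTensor_tmul, Algebra.TensorProduct.tmul_mul_tmul,
        Algebra.TensorProduct.map_tmul, AlgHom.coe_id, id_eq]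
      rw [adeleSingle_mul]
      rfl

lemma extZero_mul (y : AdelicAlg F D) (x : LocalAlg F D v) :
    extZero F D v x * y = extZero F D v (x * comp F D v y) := by
  induction y using TensorProduct.induction_on with
  | zero => simp
  | add a b ha hb => simp [mul_add, ha, hb]
  | tmul a d =>
    induction x using TensorProduct.induction_on with
    | zero => simp
    | add a b ha hb => simp [add_mul, ha, hb]
    | tmul b e =>
      simp only [extZero, comp, LinearMap.rTensor_tmul, Algebra.TensorProduct.tmul_mul_tmul,
        Algebra.TensorProduct.map_tmul, AlgHom.coe_id, id_eq]
      rw [mul_comm, adeleSingle_mul, mul_comm b]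
      rfl

lemma comp_extZero_same (x : LocalAlg F D v) : comp F D v (extZero F D v x) = x := by
  induction x using TensorProduct.induction_on with
  | zero => simp
  | add a b ha hb => simp [ha, hb]
  | tmul b e => simp [extZero, comp, adeleEval_single_same]

lemma comp_extZero_ne {w : HeightOneSpectrum (𝓞 F)} (h : w ≠ v) (x : LocalAlg F D v) :
    comp F D w (extZero F D v x) = 0 := by
  induction x using TensorProduct.induction_on with
  | zero => simp
  | add a b ha hb => simp [ha, hb]
  | tmul b e => simp [extZero, comp, adeleEval_single_ne F v h]

/-- The element with component `x` at `v` and `1` at all the other places. -/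
def extOne : LocalAlg F D v →* AdelicAlg F D where
  toFun x := extZero F D v x + (1 - extZero F D v 1)
  map_one' := by abel
  map_mul' x y := by
    simp only [mul_add, add_mul, mul_sub, sub_mul, one_mul, mul_one, extZero_mul,
      comp_extZero_same]
    abel

lemma extOne_apply (x : LocalAlg F D v) :
    extOne F v x = extZero F D v x + (1 - extZero F D v 1) := rfl

variable (D)

/-- The inclusion `D_vˣ → (𝔸_F^f ⊗_F D)ˣ` of the factor at `v`. -/
def localIncl : (LocalAlg F D v)ˣ →* (AdelicAlg F D)ˣ := Units.map (extOne F v)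

/-- The projection `(𝔸_F^f ⊗_F D)ˣ → D_vˣ`. -/
def unitComp : (AdelicAlg F D)ˣ →* (LocalAlg F D v)ˣ :=
  Units.map (comp F D v : AdelicAlg F D →* LocalAlg F D v)

/-- The diagonal inclusion `Dˣ → (𝔸_F^f ⊗_F D)ˣ`. -/
def globalIncl : Dˣ →* (AdelicAlg F D)ˣ :=
  Units.map ((Algebra.TensorProduct.includeRight : D →ₐ[F] AdelicAlg F D) : D →* AdelicAlg F D)

/-- The inclusion `(𝔸_F^f)ˣ → (𝔸_F^f ⊗_F D)ˣ`. -/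
def ideleIncl : (FiniteAdeleRing (𝓞 F) F)ˣ →* (AdelicAlg F D)ˣ :=
  Units.map (algebraMap (FiniteAdeleRing (𝓞 F) F) (AdelicAlg F D) :
    FiniteAdeleRing (𝓞 F) F →* AdelicAlg F D)

/-- The inclusion `F_vˣ → D_vˣ`. -/
def scalarIncl : (v.adicCompletion F)ˣ →* (LocalAlg F D v)ˣ :=
  Units.map (algebraMap (v.adicCompletion F) (LocalAlg F D v) :
    v.adicCompletion F →* LocalAlg F D v)

/-- The idele with component `a` at `v` and `1` at all the other places. -/
def localIdele : (v.adicCompletion F)ˣ →* (FiniteAdeleRing (𝓞 F) F)ˣ :=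
  Units.map
    { toFun := fun x => ⟨Pi.mulSingle v x, by
        filter_upwards [show {v}ᶜ ∈ Filter.cofinite by simp] with w hw
        rw [Pi.mulSingle_eq_of_ne (Set.mem_compl_singleton_iff.1 hw)]
        exact one_mem _⟩
      map_one' := FiniteAdeleRing.ext F fun w => congrFun
        (Pi.mulSingle_one (M := fun v : HeightOneSpectrum (𝓞 F) => v.adicCompletion F) v) w
      map_mul' := fun x y => FiniteAdeleRing.ext F fun w => congrFun
        (Pi.mulSingle_mul (f := fun v : HeightOneSpectrum (𝓞 F) => v.adicCompletion F) v x y) w }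

variable {F D v}

lemma unitComp_localIncl_same (x : (LocalAlg F D v)ˣ) :
    unitComp F D v (localIncl F D v x) = x := by
  ext
  simp [unitComp, localIncl, extOne_apply, comp_extZero_same]

lemma unitComp_localIncl_ne {w : HeightOneSpectrum (𝓞 F)} (h : w ≠ v) (x : (LocalAlg F D v)ˣ) :
    unitComp F D w (localIncl F D v x) = 1 := by
  ext
  simp [unitComp, localIncl, extOne_apply, comp_extZero_ne F v h]

lemma localIncl_commute {y : (AdelicAlg F D)ˣ} {x : (LocalAlg F D v)ˣ}
    (h : unitComp F D v y * x = x * unitComp F D v y) :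
    y * localIncl F D v x = localIncl F D v x * y := by
  have h' : comp F D v y.1 * x.1 = x.1 * comp F D v y.1 := congrArg Units.val h
  ext
  simp [localIncl, extOne_apply, mul_add, add_mul, mul_sub, sub_mul, mul_extZero, extZero_mul, h']

/-- `D` is ramified at the finite place `v`: the completion `D_v` is a division ring. -/
def IsRamifiedAt (F : Type u) [Field F] [NumberField F] (D : Type u) [Ring D] [Algebra F D]
    (v : HeightOneSpectrum (𝓞 F)) : Prop :=
  ∀ x : LocalAlg F D v, x ≠ 0 → IsUnit x

/-- `D` is ramified at the infinite place `w`: the completion `D_w` is a division ring. -/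
def IsRamifiedAtInfinite (F : Type u) [Field F] [NumberField F] (D : Type u) [Ring D]
    [Algebra F D] (w : InfinitePlace F) : Prop :=
  ∀ x : w.Completion ⊗[F] D, x ≠ 0 → IsUnit x

/-- An order of `D`: a subring that is a full `𝓞 F`-lattice. -/
def IsOrder (F : Type u) [Field F] [NumberField F] (D : Type u) [Ring D] [Algebra F D]
    (O : Subalgebra (𝓞 F) D) : Prop :=
  (Subalgebra.toSubmodule O).FG ∧ Submodule.span F (O : Set D) = ⊤

/-- The completion `O_v ⊆ D_v` of an order `O`, that is, the `𝓞_{F_v}`-algebra generated by `O`. -/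
def localOrder (O : Subalgebra (𝓞 F) D) (v : HeightOneSpectrum (𝓞 F)) :
    Subalgebra (v.adicCompletionIntegers F) (LocalAlg F D v) :=
  Algebra.adjoin _ ((fun d : D => (1 : v.adicCompletion F) ⊗ₜ[F] d) '' (O : Set D))

/-- The group `O_vˣ`, as a subgroup of `D_vˣ`. -/
def localOrderUnits (O : Subalgebra (𝓞 F) D) (v : HeightOneSpectrum (𝓞 F)) :
    Subgroup (LocalAlg F D v)ˣ :=
  (localOrder O v).toSubmonoid.units

end Adelic

/-! ### Quaternion algebras and levels -/

/-- A quaternion algebra `D` with centre `F`, ramified at all infinite places and at all places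
above `p`, with a maximal order `𝓞_D`, isomorphisms `𝓞_{D,v} ≅ M₂(𝓞_{F_v})` at the unramified
finite places (given as isomorphisms `D_v ≅ M₂(F_v)` that match these two orders) and
uniformisers `π_v` of the `F_v`. -/
structure QuaternionDatum (F : Type u) [Field F] [NumberField F] (p : ℕ) where
  D : Type u
  [ring : Ring D]
  [algebra : Algebra F D]
  [central : Algebra.IsCentral F D]
  [simple : IsSimpleRing D]
  finrank_eq : Module.finrank F D = 4
  ramified_infinite : ∀ w : InfinitePlace F, IsRamifiedAtInfinite F D w
  ramified_above : ∀ v : HeightOneSpectrum (𝓞 F), (p : 𝓞 F) ∈ v.asIdeal → IsRamifiedAt F D v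
  order : Subalgebra (𝓞 F) D
  order_maximal : Maximal (IsOrder F D) order
  splitting : ∀ v : HeightOneSpectrum (𝓞 F), ¬ IsRamifiedAt F D v →
    (LocalAlg F D v ≃ₐ[v.adicCompletion F] Matrix (Fin 2) (Fin 2) (v.adicCompletion F))
  mem_order_iff : ∀ (v : HeightOneSpectrum (𝓞 F)) (h : ¬ IsRamifiedAt F D v) (x : LocalAlg F D v),
    x ∈ localOrder order v ↔ ∀ i j, splitting v h x i j ∈ v.adicCompletionIntegers F
  unif : ∀ v : HeightOneSpectrum (𝓞 F), (v.adicCompletion F)ˣ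
  valuation_unif : ∀ v : HeightOneSpectrum (𝓞 F),
    Valued.v (unif v : v.adicCompletion F) = WithZero.exp (-1 : ℤ)

attribute [instance] QuaternionDatum.ring QuaternionDatum.algebra QuaternionDatum.central
  QuaternionDatum.simple

section Forms

variable {F : Type u} [Field F] [NumberField F] {p : ℕ} [Fact p.Prime]

namespace QuaternionDatum

instance (B : QuaternionDatum F p) : Module.Finite F B.D :=
  Module.finite_of_finrank_pos (by rw [B.finrank_eq]; norm_num)

/-- `(D ⊗_F 𝔸_F^f)ˣ`. -/
abbrev G (B : QuaternionDatum F p) : Type u := (AdelicAlg F B.D)ˣ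

/-- `𝓞_{D,v}ˣ`. -/
abbrev orderUnits (B : QuaternionDatum F p) (v : HeightOneSpectrum (𝓞 F)) :
    Subgroup (LocalAlg F B.D v)ˣ :=
  localOrderUnits B.order v

/-- A family `(σ_v)_{v ∣ p}` of characters `𝓞_{D,v}ˣ → 𝔽̄_pˣ`. -/
abbrev WeightChar (B : QuaternionDatum F p) : Type u :=
  ∀ v : PlacesAbove F p, B.orderUnits v.1 →* (Fbar p)ˣ

/-- The family consists of continuous characters (for the discrete topology on `𝔽̄_pˣ`),
that is, `⊗_v σ_v` is a weight: these are the irreducible smooth `𝔽̄_p`-representations of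
the groups `𝓞_{D,v}ˣ`, which are all one-dimensional. -/
def IsWeight (B : QuaternionDatum F p) (σ : B.WeightChar) : Prop :=
  ∀ v, ∃ N : Subgroup (LocalAlg F B.D v.1)ˣ, IsOpen (N : Set (LocalAlg F B.D v.1)ˣ) ∧
    ∀ x : B.orderUnits v.1, (x : (LocalAlg F B.D v.1)ˣ) ∈ N → σ v x = 1

/-- A level `U = ∏_v U_v`, together with a finite set `S` of finite places that contains
the ramified places of `D` and the places where `U_v ≠ 𝓞_{D,v}ˣ`. -/
structure Level (B : QuaternionDatum F p) where
  loc : ∀ v : HeightOneSpectrum (𝓞 F), Subgroup (LocalAlg F B.D v)ˣ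
  loc_le : ∀ v, loc v ≤ B.orderUnits v
  loc_eq : ∀ v, IsRamifiedAt F B.D v → loc v = B.orderUnits v
  isOpen : IsOpen ((⨅ v, (loc v).comap (unitComp F B.D v) : Subgroup B.G) : Set B.G)
  isCompact : IsCompact ((⨅ v, (loc v).comap (unitComp F B.D v) : Subgroup B.G) : Set B.G)
  /-- For all `t`, the group `(U (𝔸_F^f)ˣ ∩ t⁻¹ Dˣ t) / Fˣ` is trivial. -/
  neat : ∀ (t : B.G) (d : B.Dˣ) (u : B.G) (z : (FiniteAdeleRing (𝓞 F) F)ˣ),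
    u ∈ (⨅ v, (loc v).comap (unitComp F B.D v) : Subgroup B.G) →
    t⁻¹ * globalIncl F B.D d * t = u * ideleIncl F B.D z →
    ∃ a : F, (d : B.D) = algebraMap F B.D a
  S : Set (HeightOneSpectrum (𝓞 F))
  finite_S : S.Finite
  ramified_mem_S : ∀ v, IsRamifiedAt F B.D v → v ∈ S
  ne_mem_S : ∀ v, loc v ≠ B.orderUnits v → v ∈ S

namespace Level

variable {B : QuaternionDatum F p} (L : B.Level)

/-- The compact open subgroup `U = ∏_v U_v` of `(D ⊗_F 𝔸_F^f)ˣ`. -/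
def U : Subgroup B.G := ⨅ v, (L.loc v).comap (unitComp F B.D v)

lemma mem_U {u : B.G} : u ∈ L.U ↔ ∀ v, unitComp F B.D v u ∈ L.loc v := by
  simp [U, Subgroup.mem_iInf]

lemma localIncl_mem {v : HeightOneSpectrum (𝓞 F)} {x : (LocalAlg F B.D v)ˣ} (hx : x ∈ L.loc v) :
    localIncl F B.D v x ∈ L.U := by
  rw [mem_U]
  intro w
  by_cases h : w = v
  · subst h; rwa [unitComp_localIncl_same]
  · rw [unitComp_localIncl_ne h]; exact one_mem _

/-- The character of `U` by which it acts on the one-dimensional space `W_σ = ⊗_{v ∣ p} W_v`: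
`U_v` acts through `σ_v` if `v ∣ p`, and trivially otherwise. -/
def char (σ : B.WeightChar) : L.U →* (Fbar p)ˣ :=
  ∏ v : PlacesAbove F p, (σ v).comp
    (((unitComp F B.D v.1).comp L.U.subtype).codRestrict (B.orderUnits v.1)
      fun u => L.loc_le _ (L.mem_U.1 u.2 v.1))

lemma char_localIncl (σ : B.WeightChar) {v : HeightOneSpectrum (𝓞 F)}
    (hv : (p : 𝓞 F) ∉ v.asIdeal) {x : (LocalAlg F B.D v)ˣ} (hx : x ∈ L.loc v) :
    L.char σ ⟨localIncl F B.D v x, L.localIncl_mem hx⟩ = 1 := by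
  rw [char, MonoidHom.finsetProd_apply]
  refine Finset.prod_eq_one fun w _ => ?_
  have hw : w.1 ≠ v := fun h => hv (h ▸ w.2)
  rw [MonoidHom.comp_apply]
  convert map_one (σ w)
  ext1
  exact unitComp_localIncl_ne hw x

/-- The space `S_{σ,ψ}(U, 𝒪)`. A function to the discrete space `W_σ` is continuous if and only
if it is locally constant. -/
def forms (σ : B.WeightChar) (ψ : (FiniteAdeleRing (𝓞 F) F)ˣ →* (Coeff p)ˣ) :
    Submodule (Coeff p) (B.G → Fbar p) where
  carrier := {f | IsLocallyConstant f ∧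
    (∀ (d : B.Dˣ) (g : B.G), f (globalIncl F B.D d * g) = f g) ∧
    (∀ (g : B.G) (u : L.U), f (g * u) = ((L.char σ u)⁻¹ : (Fbar p)ˣ) * f g) ∧
    (∀ (g : B.G) (z : (FiniteAdeleRing (𝓞 F) F)ˣ),
      f (g * ideleIncl F B.D z) = (ψ z : Coeff p) • f g)}
  zero_mem' := ⟨IsLocallyConstant.const 0, by simp, by simp, by simp⟩
  add_mem' := by
    rintro f g ⟨h1, h2, h3, h4⟩ ⟨k1, k2, k3, k4⟩
    exact ⟨h1.add k1, by simp [h2, k2], by simp [h3, k3, mul_add], by simp [h4, k4]⟩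
  smul_mem' := by
    rintro c f ⟨h1, h2, h3, h4⟩
    exact ⟨h1.comp (c • ·), by simp [h2], by simp [h3], by simp [h4, smul_comm c]⟩

variable {L} {σ : B.WeightChar} {ψ : (FiniteAdeleRing (𝓞 F) F)ˣ →* (Coeff p)ˣ}

/-! ### Hecke operators -/

lemma forms_mul_localIncl {v : HeightOneSpectrum (𝓞 F)} (hv : (p : 𝓞 F) ∉ v.asIdeal)
    (f : L.forms σ ψ) (z : B.G) {x : (LocalAlg F B.D v)ˣ} (hx : x ∈ L.loc v) :
    f.1 (z * localIncl F B.D v x) = f.1 z := by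
  have := f.2.2.2.1 z ⟨localIncl F B.D v x, L.localIncl_mem hx⟩
  rw [char_localIncl L σ hv hx] at this
  simpa using this

/-- For `f ∈ S_{σ,ψ}(U, 𝒪)`, `z ∈ (D ⊗_F 𝔸_F^f)ˣ` and `v ∤ p`, the function `x ↦ f (z x)` on
`D_vˣ / U_v`. -/
def cosetEval {v : HeightOneSpectrum (𝓞 F)} (hv : (p : 𝓞 F) ∉ v.asIdeal) (f : L.forms σ ψ)
    (z : B.G) : (LocalAlg F B.D v)ˣ ⧸ L.loc v → Fbar p :=
  Quotient.lift (fun x => f.1 (z * localIncl F B.D v x)) (by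
    intro x y hxy
    have h : x⁻¹ * y ∈ L.loc v := QuotientGroup.leftRel_apply.1 hxy
    have := forms_mul_localIncl hv f (z * localIncl F B.D v x) h
    rw [mul_assoc, ← map_mul, mul_inv_cancel_left] at this
    exact this.symm)

lemma cosetEval_mk {v : HeightOneSpectrum (𝓞 F)} (hv : (p : 𝓞 F) ∉ v.asIdeal) (f : L.forms σ ψ)
    (z : B.G) (x : (LocalAlg F B.D v)ˣ) :
    cosetEval hv f z (x : (LocalAlg F B.D v)ˣ ⧸ L.loc v) = f.1 (z * localIncl F B.D v x) := rfl

variable (L) in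
/-- The set of cosets `U_v g U_v / U_v`. -/
def doubleCoset (v : HeightOneSpectrum (𝓞 F)) (g : (LocalAlg F B.D v)ˣ) :
    Set ((LocalAlg F B.D v)ˣ ⧸ L.loc v) :=
  MulAction.orbit (L.loc v) (g : (LocalAlg F B.D v)ˣ ⧸ L.loc v)

variable (L) in
lemma finite_doubleCoset (v : HeightOneSpectrum (𝓞 F)) (g : (LocalAlg F B.D v)ˣ) :
    (L.doubleCoset v g).Finite := by
  have hopen : IsOpen (L.U : Set B.G) := L.isOpen
  have hcomp : IsCompact (L.U : Set B.G) := L.isCompact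
  let G₀ := localIncl F B.D v g
  -- the image of the compact set `U g` in the discrete space `G / U` is finite
  have hfin : ((fun u : B.G => ((u * G₀ : B.G) : B.G ⧸ L.U)) '' (L.U : Set B.G)).Finite := by
    have hd : DiscreteTopology (B.G ⧸ L.U) := QuotientGroup.discreteTopology hopen
    refine (hcomp.image ?_).finite_of_discrete
    exact QuotientGroup.continuous_mk.comp (continuous_mul_const G₀)
  let j : (LocalAlg F B.D v)ˣ ⧸ L.loc v → B.G ⧸ L.U :=
    Quotient.map' (localIncl F B.D v) (by
      intro x y hxy
      rw [QuotientGroup.leftRel_apply] at hxy ⊢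
      rw [← map_inv, ← map_mul]
      exact L.localIncl_mem hxy)
  have hj : Function.Injective j := by
    intro a b
    induction a using QuotientGroup.induction_on with | H x =>
    induction b using QuotientGroup.induction_on with | H y =>
    intro h
    have h' := QuotientGroup.eq.1 h
    rw [← map_inv, ← map_mul, mem_U] at h'
    have := h' v
    rw [unitComp_localIncl_same] at this
    exact QuotientGroup.eq.2 this
  refine Set.Finite.of_finite_image (f := j) (hfin.subset ?_) hj.injOn
  rintro _ ⟨_, ⟨u, rfl⟩, rfl⟩
  refine ⟨localIncl F B.D v u.1, L.localIncl_mem u.2, ?_⟩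
  change ((_ : B.G) : B.G ⧸ L.U) = ((localIncl F B.D v (u.1 * g) : B.G) : B.G ⧸ L.U)
  rw [map_mul]

lemma sum_doubleCoset_smul {v : HeightOneSpectrum (𝓞 F)} (g : (LocalAlg F B.D v)ˣ)
    (u : L.loc v) (φ : (LocalAlg F B.D v)ˣ ⧸ L.loc v → Fbar p) :
    ∑ c ∈ (L.finite_doubleCoset v g).toFinset, φ (u • c) =
      ∑ c ∈ (L.finite_doubleCoset v g).toFinset, φ c := by
  refine Finset.sum_bij (fun c _ => u • c) ?_ ?_ ?_ ?_
  · intro c hc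
    rw [Set.Finite.mem_toFinset] at hc ⊢
    exact MulAction.mem_orbit_of_mem_orbit u hc
  · intro a _ b _ h
    exact MulAction.injective u h
  · intro c hc
    rw [Set.Finite.mem_toFinset] at hc
    refine ⟨u⁻¹ • c, ?_, by simp⟩
    rw [Set.Finite.mem_toFinset]
    exact MulAction.mem_orbit_of_mem_orbit u⁻¹ hc
  · intro c _; rfl

/-- The Hecke operator of the double coset `U g U` for `g ∈ D_vˣ`, `v ∤ p`:
`f ↦ ∑ x f`, that is `z ↦ ∑ f (z x)`, over `x ∈ U_v g U_v / U_v`. -/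
def hecke {v : HeightOneSpectrum (𝓞 F)} (hv : (p : 𝓞 F) ∉ v.asIdeal)
    (g : (LocalAlg F B.D v)ˣ) : Module.End (Coeff p) (L.forms σ ψ) where
  toFun f := ⟨fun z => ∑ c ∈ (L.finite_doubleCoset v g).toFinset, cosetEval hv f z c, by
    refine ⟨?_, ?_, ?_, ?_⟩
    · have : ∀ s : Finset ((LocalAlg F B.D v)ˣ ⧸ L.loc v),
          IsLocallyConstant fun z => ∑ c ∈ s, cosetEval hv f z c := by
        intro s
        induction s using Finset.induction_on with
        | empty => exact IsLocallyConstant.const 0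
        | insert a s ha ih =>
          simp only [Finset.sum_insert ha]
          refine IsLocallyConstant.add ?_ ih
          induction a using QuotientGroup.induction_on with | H x =>
          exact f.2.1.comp_continuous (continuous_mul_const (localIncl F B.D v x))
      exact this _
    · intro d z
      refine Finset.sum_congr rfl fun c _ => ?_
      induction c using QuotientGroup.induction_on with | H x =>
      rw [cosetEval_mk, cosetEval_mk, mul_assoc, f.2.2.1]
    · intro z u
      set uv : L.loc v := ⟨unitComp F B.D v u, L.mem_U.1 u.2 v⟩ with huv
      have hl := L.localIncl_mem uv.2
      set w : L.U := ⟨localIncl F B.D v uv, hl⟩⁻¹ * u with hw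
      have hchar : L.char σ w = L.char σ u := by
        rw [hw, map_mul, map_inv, char_localIncl L σ hv uv.2, inv_one, one_mul]
      have hw1 : unitComp F B.D v (w : B.G) = 1 := by
        rw [hw, Subgroup.coe_mul, Subgroup.coe_inv, map_mul, map_inv,
          unitComp_localIncl_same, huv]
        simp
      have hu : (u : B.G) = localIncl F B.D v uv * w := by
        rw [hw, Subgroup.coe_mul, Subgroup.coe_inv, mul_inv_cancel_left]
      have key : ∀ c, cosetEval hv f (z * u) c =
          ((L.char σ u)⁻¹ : (Fbar p)ˣ) * cosetEval hv f z (uv • c) := by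
        intro c
        induction c using QuotientGroup.induction_on with | H x =>
        have hcomm : (w : B.G) * localIncl F B.D v x = localIncl F B.D v x * w :=
          localIncl_commute (by rw [hw1, one_mul, mul_one])
        change f.1 (z * u * localIncl F B.D v x) = _ * f.1 (z * localIncl F B.D v (uv.1 * x))
        rw [← hchar, ← f.2.2.2.1 _ w, map_mul, hu]
        simp only [mul_assoc, hcomm]
      simp only [key, ← Finset.mul_sum]
      rw [sum_doubleCoset_smul g uv (fun c => cosetEval hv f z c)]
    · intro z a
      rw [Finset.smul_sum]
      refine Finset.sum_congr rfl fun c _ => ?_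
      induction c using QuotientGroup.induction_on with | H x =>
      rw [cosetEval_mk, cosetEval_mk, ← f.2.2.2.2]
      have : ideleIncl F B.D a * localIncl F B.D v x = localIncl F B.D v x * ideleIncl F B.D a := by
        ext
        exact Algebra.commutes _ _
      rw [mul_assoc, this, mul_assoc]⟩
  map_add' f g := by
    ext z
    simp only [Submodule.coe_add, Pi.add_apply, ← Finset.sum_add_distrib]
    refine Finset.sum_congr rfl fun c _ => ?_
    induction c using QuotientGroup.induction_on with | H x => rfl
  map_smul' a f := by
    ext z
    simp only [Submodule.coe_smul, Pi.smul_apply, Finset.smul_sum, RingHom.id_apply]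
    refine Finset.sum_congr rfl fun c _ => ?_
    induction c using QuotientGroup.induction_on with | H x => rfl

lemma hecke_apply {v : HeightOneSpectrum (𝓞 F)} (hv : (p : 𝓞 F) ∉ v.asIdeal)
    (g : (LocalAlg F B.D v)ˣ) (f : L.forms σ ψ) (z : B.G) :
    (hecke hv g f).1 z = ∑ c ∈ (L.finite_doubleCoset v g).toFinset, cosetEval hv f z c := rfl

lemma hecke_commute_ne {v w : HeightOneSpectrum (𝓞 F)} (hv : (p : 𝓞 F) ∉ v.asIdeal)
    (hw : (p : 𝓞 F) ∉ w.asIdeal) (h : v ≠ w) (g : (LocalAlg F B.D v)ˣ)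
    (k : (LocalAlg F B.D w)ˣ) :
    (hecke hv g * hecke hw k : Module.End (Coeff p) (L.forms σ ψ)) = hecke hw k * hecke hv g := by
  ext f z
  simp only [Module.End.mul_apply, hecke_apply]
  have key : ∀ (c : (LocalAlg F B.D v)ˣ ⧸ L.loc v) (d : (LocalAlg F B.D w)ˣ ⧸ L.loc w),
      (cosetEval hw f (z * localIncl F B.D v c.out) d : Fbar p) =
        cosetEval hv f (z * localIncl F B.D w d.out) c := by
    intro c d
    have hcomm : localIncl F B.D v c.out * localIncl F B.D w d.out =
        localIncl F B.D w d.out * localIncl F B.D v c.out :=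
      localIncl_commute (by rw [unitComp_localIncl_ne h.symm, one_mul, mul_one])
    have h1 := cosetEval_mk hw f (z * localIncl F B.D v c.out) d.out
    have h2 := cosetEval_mk hv f (z * localIncl F B.D w d.out) c.out
    rw [QuotientGroup.out_eq'] at h1 h2
    rw [h1, h2, mul_assoc, hcomm, mul_assoc]
  have e1 : ∀ (f' : L.forms σ ψ) (c : (LocalAlg F B.D v)ˣ ⧸ L.loc v),
      cosetEval hv f' z c = f'.1 (z * localIncl F B.D v c.out) := fun f' c => by
    rw [← cosetEval_mk hv, QuotientGroup.out_eq']
  have e2 : ∀ (f' : L.forms σ ψ) (c : (LocalAlg F B.D w)ˣ ⧸ L.loc w),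
      cosetEval hw f' z c = f'.1 (z * localIncl F B.D w c.out) := fun f' c => by
    rw [← cosetEval_mk hw, QuotientGroup.out_eq']
  simp only [e1, e2, hecke_apply, key]
  exact Finset.sum_comm

lemma hecke_central {v : HeightOneSpectrum (𝓞 F)} (hv : (p : 𝓞 F) ∉ v.asIdeal)
    {g : (LocalAlg F B.D v)ˣ} (hg : ∀ x, g * x = x * g) (f : L.forms σ ψ) (z : B.G) :
    (hecke hv g f).1 z = f.1 (z * localIncl F B.D v g) := by
  have : L.doubleCoset v g = {(g : (LocalAlg F B.D v)ˣ ⧸ L.loc v)} := by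
    ext c
    rw [Set.mem_singleton_iff]
    constructor
    · rintro ⟨u, rfl⟩
      change ((u.1 * g : (LocalAlg F B.D v)ˣ) : (LocalAlg F B.D v)ˣ ⧸ L.loc v) = _
      rw [← hg]
      exact QuotientGroup.mk_mul_of_mem g u.2
    · rintro rfl
      exact MulAction.mem_orbit_self _
  rw [hecke_apply]
  simp only [this, Set.Finite.toFinset_singleton, Finset.sum_singleton, cosetEval_mk]

lemma hecke_commute_central {v : HeightOneSpectrum (𝓞 F)} (hv : (p : 𝓞 F) ∉ v.asIdeal)
    {g : (LocalAlg F B.D v)ˣ} (hg : ∀ x, g * x = x * g) (k : (LocalAlg F B.D v)ˣ) :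
    (hecke hv g * hecke hv k : Module.End (Coeff p) (L.forms σ ψ)) = hecke hv k * hecke hv g := by
  ext f z
  rw [Module.End.mul_apply, Module.End.mul_apply, hecke_central hv hg, hecke_apply, hecke_apply]
  refine Finset.sum_congr rfl fun c _ => ?_
  induction c using QuotientGroup.induction_on with | H x =>
  rw [cosetEval_mk, cosetEval_mk, hecke_central hv hg, mul_assoc, mul_assoc, ← map_mul, ← map_mul,
    hg]

variable (L) in
/-- The formal variables `T_v`, `S_v` for `v ∉ S`. -/
inductive HeckeVar : Type u
  | T (v : HeightOneSpectrum (𝓞 F)) (hv : v ∉ L.S)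
  | S (v : HeightOneSpectrum (𝓞 F)) (hv : v ∉ L.S)

variable (L) in
/-- The polynomial ring `𝕋^univ_{S,𝒪} = 𝒪[T_v, S_v]_{v ∉ S}`. -/
abbrev HeckeAlg : Type u := MvPolynomial L.HeckeVar (Coeff p)

lemma not_ramified {v : HeightOneSpectrum (𝓞 F)} (hv : v ∉ L.S) : ¬ IsRamifiedAt F B.D v :=
  fun h => hv (L.ramified_mem_S v h)

lemma not_above {v : HeightOneSpectrum (𝓞 F)} (hv : v ∉ L.S) : (p : 𝓞 F) ∉ v.asIdeal :=
  fun h => not_ramified hv (B.ramified_above v h)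

end Level

/-- The element of `D_vˣ` that corresponds to `diag(π_v, 1) ∈ GL₂(F_v)`. -/
def diagUnif (B : QuaternionDatum F p) {v : HeightOneSpectrum (𝓞 F)}
    (h : ¬ IsRamifiedAt F B.D v) : (LocalAlg F B.D v)ˣ :=
  Units.map ((B.splitting v h).symm :
      Matrix (Fin 2) (Fin 2) (v.adicCompletion F) →* LocalAlg F B.D v)
    (Matrix.GeneralLinearGroup.mkOfDetNeZero !![(B.unif v : v.adicCompletion F), 0; 0, 1]
      (by simp))

/-- The element of `D_vˣ` that corresponds to `diag(π_v, π_v) ∈ GL₂(F_v)`. -/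
def scalarUnif (B : QuaternionDatum F p) {v : HeightOneSpectrum (𝓞 F)}
    (h : ¬ IsRamifiedAt F B.D v) : (LocalAlg F B.D v)ˣ :=
  Units.map ((B.splitting v h).symm :
      Matrix (Fin 2) (Fin 2) (v.adicCompletion F) →* LocalAlg F B.D v)
    (Matrix.GeneralLinearGroup.mkOfDetNeZero
      !![(B.unif v : v.adicCompletion F), 0; 0, (B.unif v : v.adicCompletion F)] (by simp))

lemma scalarUnif_central (B : QuaternionDatum F p) {v : HeightOneSpectrum (𝓞 F)}
    (h : ¬ IsRamifiedAt F B.D v) (x : (LocalAlg F B.D v)ˣ) :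
    B.scalarUnif h * x = x * B.scalarUnif h := by
  have : (B.scalarUnif h : LocalAlg F B.D v) =
      algebraMap (v.adicCompletion F) _ (B.unif v : v.adicCompletion F) := by
    rw [← (B.splitting v h).symm.commutes]
    change (B.splitting v h).symm _ = _
    congr 1
    ext i j
    fin_cases i <;> fin_cases j <;>
      simp [Matrix.algebraMap_matrix_apply, Matrix.GeneralLinearGroup.mkOfDetNeZero]
  ext
  rw [Units.val_mul, Units.val_mul, this]
  exact Algebra.commutes _ _

namespace Level

variable {B : QuaternionDatum F p} (L : B.Level) (σ : B.WeightChar)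
  (ψ : (FiniteAdeleRing (𝓞 F) F)ˣ →* (Coeff p)ˣ)

/-- The operators on `S_{σ,ψ}(U, 𝒪)` by which `T_v` and `S_v` act, namely the double cosets of
`diag(π_v, 1)` and `diag(π_v, π_v)`. -/
def heckeVar : L.HeckeVar → Module.End (Coeff p) (L.forms σ ψ)
  | .T _ hv => hecke (not_above hv) (B.diagUnif (not_ramified hv))
  | .S _ hv => hecke (not_above hv) (B.scalarUnif (not_ramified hv))

lemma heckeVar_commute (s t : L.HeckeVar) :
    L.heckeVar σ ψ s * L.heckeVar σ ψ t = L.heckeVar σ ψ t * L.heckeVar σ ψ s := by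
  rcases s with ⟨v, hv⟩ | ⟨v, hv⟩ <;> rcases t with ⟨w, hw⟩ | ⟨w, hw⟩ <;>
    by_cases h : v = w
  · subst h; rfl
  · exact hecke_commute_ne _ _ h _ _
  · subst h; exact (hecke_commute_central _ (B.scalarUnif_central _) _).symm
  · exact hecke_commute_ne _ _ h _ _
  · subst h; exact hecke_commute_central _ (B.scalarUnif_central _) _
  · exact hecke_commute_ne _ _ h _ _
  · subst h; rfl
  · exact hecke_commute_ne _ _ h _ _

instance : IsMulCommutative (Algebra.adjoin (Coeff p) (Set.range (L.heckeVar σ ψ))) :=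
  Algebra.isMulCommutative_adjoin (Coeff p) (by
    rintro _ ⟨s, rfl⟩ _ ⟨t, rfl⟩
    exact L.heckeVar_commute σ ψ s t)

open scoped IsMulCommutative in
/-- The action of `𝕋^univ_{S,𝒪}` on `S_{σ,ψ}(U, 𝒪)`. -/
def heckeAction : L.HeckeAlg →ₐ[Coeff p] Module.End (Coeff p) (L.forms σ ψ) :=
  (Algebra.adjoin (Coeff p) (Set.range (L.heckeVar σ ψ))).val.comp
    (MvPolynomial.aeval fun s => ⟨L.heckeVar σ ψ s, Algebra.subset_adjoin ⟨s, rfl⟩⟩)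

lemma heckeAction_X (s : L.HeckeVar) :
    L.heckeAction σ ψ (MvPolynomial.X s) = L.heckeVar σ ψ s := by
  simp [heckeAction]

/-- The maximal ideal `𝔪` is in the support of `(σ, ψ)`: the localisation
`S_{σ,ψ}(U, 𝒪)_𝔪` is nonzero. -/
def InSupport (m : Ideal L.HeckeAlg) [m.IsPrime] : Prop :=
  letI : Module L.HeckeAlg (L.forms σ ψ) :=
    Module.compHom (L.forms σ ψ) (L.heckeAction σ ψ).toRingHom
  Nontrivial (LocalizedModule m.primeCompl (L.forms σ ψ))

/-- `ψ : Fˣ \ (𝔸_F^f)ˣ → 𝒪ˣ` is a continuous character such that for all finite places `v`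
the restriction of `σ` to `U_v ∩ 𝓞_{F_v}ˣ` is multiplication by `ψ⁻¹`. (An element of `F_vˣ`
that lies in `U_v ⊆ 𝓞_{D,v}ˣ` is in `𝓞_{F_v}ˣ`.) -/
def IsCentralChar : Prop :=
  Continuous ψ ∧
  (∀ a : Fˣ, ψ (FiniteAdeleRing.unitEmbedding (𝓞 F) F a) = 1) ∧
  ∀ (v : HeightOneSpectrum (𝓞 F)) (a : (v.adicCompletion F)ˣ)
    (ha : scalarIncl F B.D v a ∈ L.loc v),
    L.char σ ⟨localIncl F B.D v (scalarIncl F B.D v a), L.localIncl_mem ha⟩ =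
      (Units.map (IsLocalRing.residue (Coeff p) : Coeff p →* Fbar p) (ψ (localIdele F v a)))⁻¹

end Level
end QuaternionDatum

/-! ### Galois representations -/

/-- The absolute Galois group of `F`. -/
abbrev GalF (F : Type u) [Field F] : Type u := Gal(AlgebraicClosure F/F)

/-- `ρ` is semisimple: each stable subspace has a stable complement. -/
def IsSemisimpleRep (ρ : GalF F →* GL (Fin 2) (Fbar p)) : Prop :=
  ∀ W : Submodule (Fbar p) (Fin 2 → Fbar p),
    (∀ g, ∀ x ∈ W, (ρ g).1.mulVec x ∈ W) →
    ∃ W' : Submodule (Fbar p) (Fin 2 → Fbar p),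
      (∀ g, ∀ x ∈ W', (ρ g).1.mulVec x ∈ W') ∧ IsCompl W W'

/-- `ρ ≅ ρ̄_𝔪`, where `θ : 𝕋^univ → 𝕋^univ / 𝔪 = 𝔽̄_p` is the reduction modulo `𝔪`: that is, `ρ` is
semisimple, and for `v ∉ S` it is unramified at `v` and an arithmetic Frobenius at `v` has
characteristic polynomial `X² - T_v X + S_v 𝐍v`. The decomposition groups at `v` are indexed by the
primes `Q` above `v` of the ring of all algebraic integers. -/
def IsAssociated {B : QuaternionDatum F p} (L : B.Level) (ρ : GalF F →* GL (Fin 2) (Fbar p))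
    (θ : L.HeckeAlg →ₐ[Coeff p] Fbar p) : Prop :=
  IsSemisimpleRep ρ ∧
  ∀ (v : HeightOneSpectrum (𝓞 F)) (hv : v ∉ L.S) (Q : Ideal (𝓞 (AlgebraicClosure F))),
    Q.IsPrime → Q.under (𝓞 F) = v.asIdeal →
    (∀ g : GalF F, (∀ x : 𝓞 (AlgebraicClosure F), g • x - x ∈ Q) → ρ g = 1) ∧
    (∀ g : GalF F, (∀ x : 𝓞 (AlgebraicClosure F), g • x - x ^ Nat.card (𝓞 F ⧸ v.asIdeal) ∈ Q) →
      (ρ g).1.charpoly =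
        Polynomial.X ^ 2 - Polynomial.C (θ (MvPolynomial.X (.T v hv))) * Polynomial.X +
          Polynomial.C (θ (MvPolynomial.X (.S v hv)) * (Nat.card (𝓞 F ⧸ v.asIdeal) : Fbar p)))

/-! ### Modularity of a given weight -/

/-- `ρ` is modular of weight `σ` for the given quaternion algebra: for some `U`, `S`, `ψ` and some
maximal ideal `𝔪` with residue field `𝔽̄_p`, we have `S_{σ,ψ}(U, 𝒪)_𝔪 ≠ 0` and `ρ̄_𝔪 ≅ ρ`. -/
def QuaternionDatum.IsModularOfWeight (B : QuaternionDatum F p)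
    (ρ : GalF F →* GL (Fin 2) (Fbar p)) (σ : B.WeightChar) : Prop :=
  ∃ (L : B.Level) (ψ : (FiniteAdeleRing (𝓞 F) F)ˣ →* (Coeff p)ˣ), L.IsCentralChar σ ψ ∧
    ∃ (m : Ideal L.HeckeAlg) (_ : m.IsMaximal) (θ : L.HeckeAlg →ₐ[Coeff p] Fbar p),
      RingHom.ker θ = m ∧ L.InSupport σ ψ m ∧ IsAssociated L ρ θ

/-- Replace the component `σ_v` of a family of characters by `σ_v ^ q_v`, where `q_v` is the order
of the residue field of `F_v`. -/
def frobTwist {Γ : PlacesAbove F p → Type*} [∀ w, Monoid (Γ w)] (v : PlacesAbove F p)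
    (σ : ∀ w, Γ w →* (Fbar p)ˣ) : ∀ w, Γ w →* (Fbar p)ˣ :=
  Function.update σ v (σ v ^ Nat.card (𝓞 F ⧸ v.1.asIdeal))

/-- An identification of the residue fields of the rings `𝓞_{D,v}`, `v ∣ p`, with given extensions
`k₂ v` of the residue fields `k_v` of `F`. -/
structure ResidueIdent (B : QuaternionDatum F p) (k₂ : PlacesAbove F p → Type u)
    [∀ v, Field (k₂ v)] [∀ v, Algebra (𝓞 F ⧸ v.1.asIdeal) (k₂ v)] where
  red : ∀ v : PlacesAbove F p, localOrder B.order v.1 →+* k₂ v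
  surjective : ∀ v, Function.Surjective (red v)
  red_algebraMap : ∀ (v : PlacesAbove F p) (a : 𝓞 F),
    red v (algebraMap (v.1.adicCompletionIntegers F) _ (algebraMap (𝓞 F) _ a)) =
      algebraMap (𝓞 F ⧸ v.1.asIdeal) (k₂ v) (Ideal.Quotient.mk _ a)

/-- The characters of the groups `𝓞_{D,v}ˣ` obtained from characters of `(k₂ v)ˣ`. -/
def ResidueIdent.pullback {B : QuaternionDatum F p} {k₂ : PlacesAbove F p → Type u}
    [∀ v, Field (k₂ v)] [∀ v, Algebra (𝓞 F ⧸ v.1.asIdeal) (k₂ v)] (ι : ResidueIdent B k₂)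
    (τ : ∀ v, (k₂ v)ˣ →* (Fbar p)ˣ) : B.WeightChar := fun v =>
  ((τ v).comp (Units.map (ι.red v : localOrder B.order v.1 →* k₂ v))).comp
    (Submonoid.unitsEquivUnitsType (localOrder B.order v.1).toSubmonoid).toMonoidHom

/-- `ρ` is modular of weight `τ`, a family of characters of the groups `(k₂ v)ˣ`: it is so for some
quaternion algebra `D` as above, where the `k₂ v` are identified with the residue fields of the
rings `𝓞_{D,v}` by means of `ι`. -/
def IsModularOfWeight {k₂ : PlacesAbove F p → Type u} [∀ v, Field (k₂ v)]
    [∀ v, Algebra (𝓞 F ⧸ v.1.asIdeal) (k₂ v)] (ι : ∀ B : QuaternionDatum F p, ResidueIdent B k₂)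
    (ρ : GalF F →* GL (Fin 2) (Fbar p)) (τ : ∀ v, (k₂ v)ˣ →* (Fbar p)ˣ) : Prop :=
  ∃ B : QuaternionDatum F p, B.IsModularOfWeight ρ ((ι B).pullback τ)

end Forms

end SerreWeight

end

noncomputable section

namespace SerreWeight

/-! ### Central division algebras of dimension four -/

section DivisionAlgebra

variable {K A : Type*} [Field K] [Ring A] [Algebra K A]

/-! Conjugate weights have isomorphic spaces of forms. At `v ∣ p` the level is all of `𝓞_{D,v}ˣ`,
and `D_vˣ` normalises this group because it is the unit group of the valuation ring of the division
algebra `D_v`. So for `a ∈ D_vˣ` the map `f ↦ f(· a⁻¹)` is injective from forms of weight `σ` to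
forms of the weight with `v`-component `x ↦ σ_v(a x a⁻¹)`. The character `ψ` stays the same since
scalars commute with `a`, and the map commutes with `T_w` and `S_w` since these operators involve
only places `w ∤ p`. Hence the same maximal ideals occur, and with them the same Galois
representations; the inverse of `a` gives the converse. This part rests on `IsConj.translate`,
`IsConj.hecke_translate` and `IsConj.inSupport`.

It remains to find `a` with `σ_v(a x a⁻¹) = σ_v(x) ^ q_v`. A weight is trivial on principal units:
their `p ^ n`-th powers tend to `1`, and `𝔽̄_pˣ` has no `p`-torsion (`isTame_of_isOpen`). So it is
enough that conjugation by `a` induces the `q_v`-Frobenius on the residue field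
(`exists_conj_frobenius`). The element `a` is found without a uniformiser. Each noncentral `x`
satisfies `x² = t x - n` and is conjugate to `t - x` (`exists_conj_eq`). If `x` lifts a generator
`g` of the multiplicative group of the residue field and `g ^ q ≠ g`, then `g ^ q` is the other root
of the reduced quadratic, so the conjugation that takes `x` to `t - x` acts on residues as
Frobenius.

The valuation of `D_v` is `w = v ∘ N`, with `N` the norm of the regular representation
(`normValuation`). Its ultrametric inequality comes from Hensel's lemma for `Y² - Y + c`. On `F_v`
it restricts to the fourth power of `v`, which is the source of the exponents `4`. To apply it to
the given maximal order, `mem_localOrder_iff` identifies the completion of that order with `{w ≤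
1}`: enlarging the order at `v` by all `v`-integral elements yields again an order, by integrality
of traces, so maximality forces equality. -/

lemma exists_mul_eq_one_of_isUnit {x : A} (h : IsUnit x) : ∃ y, x * y = 1 ∧ y * x = 1 :=
  isUnit_iff_exists.1 h

/-- An element all of whose powers span a subspace of dimension at least three of a division
algebra of dimension four is central. -/
lemma commute_of_linearIndependent (hA : ∀ x : A, x ≠ 0 → IsUnit x)
    (h4 : Module.finrank K A = 4) {x : A} (hx : LinearIndependent K ![1, x, x ^ 2]) (y : A) :
    x * y = y * x := by
  have : Module.Finite K A := Module.finite_of_finrank_pos (by omega)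
  by_cases hy : y = 0
  · simp [hy]
  obtain ⟨z, hz, hz'⟩ := exists_mul_eq_one_of_isUnit (hA y hy)
  set W : Submodule K A := Submodule.span K (Set.range ![1, x, x ^ 2]) with hW
  have hWx : ∀ w ∈ W, Commute x w := by
    intro w hw
    induction hw using Submodule.span_induction with
    | mem w hw =>
      obtain ⟨i, rfl⟩ := hw
      fin_cases i
      · exact Commute.one_right x
      · exact Commute.refl x
      · exact (Commute.refl x).pow_right 2
    | zero => exact Commute.zero_right x
    | add a b _ _ ha hb => exact ha.add_right hb
    | smul c a _ ha => exact ha.smul_right c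
  have hinj : Function.Injective (LinearMap.mulRight K y) := by
    intro a b hab
    have : a * y * z = b * y * z := congrArg (· * z) hab
    simpa [mul_assoc, hz] using this
  have hd : Module.finrank K W = 3 := by
    rw [hW, finrank_span_eq_card hx]; simp
  have hd' : Module.finrank K (W.map (LinearMap.mulRight K y)) = 3 := by
    rw [← hd]; exact (Submodule.equivMapOfInjective _ hinj W).finrank_eq.symm
  -- `W` and `W y` both have dimension three in a space of dimension four, so they meet. A common
  -- nonzero element is `w' y` with `w'` and `w' y` both commuting with `x`; cancelling `w'` shows
  -- that `y` commutes with `x`.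
  have hne : W ⊓ W.map (LinearMap.mulRight K y) ≠ ⊥ := by
    intro h
    have h1 := Submodule.finrank_sup_add_finrank_inf_eq W (W.map (LinearMap.mulRight K y))
    have h2 := Submodule.finrank_le (W ⊔ W.map (LinearMap.mulRight K y))
    rw [h, finrank_bot] at h1
    omega
  obtain ⟨w, ⟨hw, w', hw', rfl⟩, hw0⟩ := Submodule.exists_mem_ne_zero_of_ne_bot hne
  have hw'0 : w' ≠ 0 := by rintro rfl; simp at hw0
  obtain ⟨u, hu, hu'⟩ := exists_mul_eq_one_of_isUnit (hA w' hw'0)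
  have h1 : Commute x (w' * y) := hWx _ hw
  have h2 : Commute x w' := hWx _ hw'
  have h3 : w' * (x * y) = w' * (y * x) := by
    rw [← mul_assoc, ← h2.eq, mul_assoc, h1.eq, mul_assoc]
  have := congrArg (u * ·) h3
  simpa [← mul_assoc, hu'] using this

variable (hA : ∀ x : A, x ≠ 0 → IsUnit x) (h4 : Module.finrank K A = 4)
  (hc : ∀ x : A, (∀ y, x * y = y * x) → ∃ c : K, algebraMap K A c = x)
include hA h4 hc

/-- Each element of a central division algebra of dimension four is a root of a polynomial
`X² - t X + n`. -/
lemma exists_quadratic (x : A) : ∃ t n : K, x * x = t • x - algebraMap K A n := by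
  have : Module.Finite K A := Module.finite_of_finrank_pos (by omega)
  have : Nontrivial A := Module.nontrivial_of_finrank_pos (R := K) (by omega)
  have hK : ∀ c : K, ∃ t n : K, algebraMap K A c * algebraMap K A c =
      t • algebraMap K A c - algebraMap K A n := by
    intro c
    refine ⟨2 * c, c * c, ?_⟩
    rw [Algebra.smul_def, ← map_mul, ← map_mul, ← map_sub]
    congr 1; ring
  by_cases hx : LinearIndependent K ![1, x, x ^ 2]
  · obtain ⟨c, rfl⟩ := hc x (commute_of_linearIndependent hA h4 hx)
    exact hK c
  · rw [Fintype.not_linearIndependent_iff] at hx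
    obtain ⟨g, hg, i, hi⟩ := hx
    simp only [Fin.sum_univ_three, Matrix.cons_val_zero, Matrix.cons_val_one,
      Matrix.cons_val] at hg
    by_cases h2 : g 2 = 0
    · rw [h2, zero_smul, add_zero] at hg
      have h1 : g 1 ≠ 0 := by
        intro h1
        rw [h1, zero_smul, add_zero] at hg
        have h0 : g 0 = 0 := (smul_eq_zero.1 hg).resolve_right one_ne_zero
        fin_cases i <;> simp_all
      have : x = algebraMap K A (-(g 0) / g 1) := by
        have h3 : g 1 • x = -(g 0 • (1 : A)) := by rw [eq_neg_iff_add_eq_zero, add_comm, hg]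
        have := congrArg ((g 1)⁻¹ • ·) h3
        simp only [smul_smul, inv_mul_cancel₀ h1, one_smul] at this
        rw [this, Algebra.algebraMap_eq_smul_one, ← neg_smul, smul_smul]
        congr 1; field_simp
      rw [this]; exact hK _
    · refine ⟨-(g 1) / g 2, g 0 / g 2, ?_⟩
      have h3 : g 2 • x ^ 2 = -(g 1 • x) - g 0 • (1 : A) := by
        rw [← sub_eq_zero, ← hg]; abel
      have := congrArg ((g 2)⁻¹ • ·) h3
      simp only [smul_smul, inv_mul_cancel₀ h2, one_smul] at this
      rw [← sq, this, Algebra.algebraMap_eq_smul_one, smul_sub, ← neg_smul, smul_smul, smul_smul]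
      congr 2 <;> field_simp

omit h4 in
/-- An element that is not in the centre is conjugate to the other root of its minimal
polynomial. -/
lemma exists_conj_eq {x : A} (hx : ∀ c : K, algebraMap K A c ≠ x) {t n : K}
    (h : x * x = t • x - algebraMap K A n) :
    ∃ a : Aˣ, (a : A) * x * (a⁻¹ : Aˣ) = algebraMap K A t - x := by
  obtain ⟨b, hb⟩ : ∃ b, x * b ≠ b * x := by
    by_contra! H
    obtain ⟨c, hcx⟩ := hc x H
    exact hx c hcx
  obtain ⟨a, ha⟩ := hA (x * b - b * x) (sub_ne_zero.2 hb)
  refine ⟨a, ?_⟩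
  rw [Units.mul_inv_eq_iff_eq_mul, ha]
  have e1 : b * (x * x) = t • (b * x) - algebraMap K A n * b := by
    rw [h, mul_sub, mul_smul_comm, Algebra.commutes]
  have e2 : x * (x * b) = t • (x * b) - algebraMap K A n * b := by
    rw [← mul_assoc, h, sub_mul, smul_mul_assoc]
  rw [sub_mul, sub_mul, mul_sub, mul_sub, mul_assoc b, e1, e2, mul_assoc]
  simp only [Algebra.smul_def]
  abel

omit hA hc in
lemma norm_algebraMap_of_finrank_four (c : K) : Algebra.norm K (algebraMap K A c) = c ^ 4 := by
  have : Module.Finite K A := Module.finite_of_finrank_pos (by omega)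
  rw [Algebra.norm_algebraMap, h4]

omit hA hc in
lemma trace_lmul_algebraMap (c : K) :
    LinearMap.trace K A (Algebra.lmul K A (algebraMap K A c)) = 4 * c := by
  have : Module.Finite K A := Module.finite_of_finrank_pos (by omega)
  rw [AlgHom.commutes, Algebra.algebraMap_eq_smul_one, map_smul, LinearMap.trace_one, h4]
  simp [mul_comm]

/-- The conjugate elements `x` and `t - x` have the same regular trace and norm, while their sum `t`
and product `n` are scalars, of trace `4 t` and norm `n ^ 4`. Nothing is divided by `2` and no
square root is taken, so the relations hold in every characteristic. -/
lemma trace_norm_of_quadratic {x : A} (hx : ∀ c : K, algebraMap K A c ≠ x) {t n : K}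
    (h : x * x = t • x - algebraMap K A n) :
    2 * LinearMap.trace K A (Algebra.lmul K A x) = 4 * t ∧ Algebra.norm K x ^ 2 = n ^ 4 := by
  have : Module.Finite K A := Module.finite_of_finrank_pos (by omega)
  obtain ⟨a, ha⟩ := exists_conj_eq hA hc hx h
  constructor
  · have h1 : LinearMap.trace K A (Algebra.lmul K A ((a : A) * x * (a⁻¹ : Aˣ))) =
        LinearMap.trace K A (Algebra.lmul K A x) := by
      rw [map_mul, LinearMap.trace_mul_comm, ← map_mul, ← mul_assoc, Units.inv_mul, one_mul]
    rw [ha, map_sub, map_sub, trace_lmul_algebraMap h4] at h1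
    linear_combination -h1
  · have h1 : Algebra.norm K ((a : A) * x * (a⁻¹ : Aˣ)) = Algebra.norm K x := by
      rw [map_mul, mul_comm, ← map_mul, ← mul_assoc, Units.inv_mul, one_mul]
    have h2 : x * (algebraMap K A t - x) = algebraMap K A n := by
      rw [mul_sub, h, Algebra.smul_def, Algebra.commutes]; abel
    rw [← norm_algebraMap_of_finrank_four h4, ← h2, map_mul, ← ha, h1, sq]

omit hA h4 hc in
lemma algebraMap_mul_self (c : K) : algebraMap K A c * algebraMap K A c =
    (2 * c) • algebraMap K A c - algebraMap K A (c ^ 2) := by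
  rw [Algebra.smul_def, ← map_mul, ← map_mul, ← map_sub]
  congr 1; ring

/-- For a nonscalar `x` the quadratic polynomial is minimal, so it divides any monic polynomial over
`R` that kills `x`, and Gauss's lemma puts its coefficients in `R`. A scalar `r` is a root of `(X -
r)²`. -/
lemma exists_quadratic_of_isIntegral {R : Type*} [CommRing R] [IsDomain R]
    [IsIntegrallyClosed R]
    [Algebra R K] [IsFractionRing R K] [Algebra R A] [IsScalarTower R K A] {x : A}
    (hx : IsIntegral R x) : ∃ t n : R,
      2 * LinearMap.trace K A (Algebra.lmul K A x) = 4 * algebraMap R K t ∧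
      Algebra.norm K x ^ 2 = algebraMap R K n ^ 4 := by
  have : Nontrivial A := Module.nontrivial_of_finrank_pos (R := K) (by omega)
  by_cases hxK : ∃ c : K, algebraMap K A c = x
  · obtain ⟨c, rfl⟩ := hxK
    have hc : IsIntegral R c :=
      (isIntegral_algebraMap_iff (FaithfulSMul.algebraMap_injective K A)).1 hx
    obtain ⟨r, rfl⟩ := IsIntegrallyClosed.isIntegral_iff.1 hc
    refine ⟨2 * r, r ^ 2, ?_, ?_⟩
    · rw [trace_lmul_algebraMap h4, map_mul, map_ofNat]; ring
    · rw [norm_algebraMap_of_finrank_four h4, map_pow]; ring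
  · push Not at hxK
    obtain ⟨t, n, h⟩ := exists_quadratic hA h4 hc x
    obtain ⟨P, hP, hPx⟩ := hx
    set Q : K[X] := Polynomial.X ^ 2 + Polynomial.C (-t) * Polynomial.X + Polynomial.C n with hQ
    have hQm : Q.Monic := by rw [hQ]; monicity!
    have hQd : Q.natDegree = 2 := by rw [hQ]; compute_degree!
    have hQx : Polynomial.aeval x Q = 0 := by
      simp only [hQ, map_add, map_mul, Polynomial.aeval_X, Polynomial.aeval_C, sq, h,
        Algebra.smul_def, map_neg]
      noncomm_ring
    have hPK : Polynomial.aeval x (P.map (algebraMap R K)) = 0 := by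
      rw [Polynomial.aeval_map_algebraMap]; exact hPx
    have hrem : Polynomial.aeval x (P.map (algebraMap R K) %ₘ Q) = 0 := by
      rw [← Polynomial.modByMonic_add_div (P.map (algebraMap R K)) Q] at hPK
      simpa [hQx] using hPK
    have hdvd : Q ∣ P.map (algebraMap R K) := by
      rw [← Polynomial.modByMonic_eq_zero_iff_dvd hQm]
      have hdeg : (P.map (algebraMap R K) %ₘ Q).natDegree ≤ 1 := by
        have := Polynomial.natDegree_modByMonic_lt (P.map (algebraMap R K)) hQm
          (by intro h; rw [h] at hQd; simp at hQd)
        omega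
      -- The remainder `a X + b` also kills `x`. If `a ≠ 0` then `x` would be the scalar `-b / a`.
      obtain ⟨a, b, hab⟩ := Polynomial.exists_eq_X_add_C_of_natDegree_le_one hdeg
      rw [hab] at hrem ⊢
      simp only [map_add, map_mul, Polynomial.aeval_X, Polynomial.aeval_C] at hrem
      by_cases ha : a = 0
      · subst ha
        rw [map_zero, zero_mul, zero_add] at hrem
        rw [(map_eq_zero_iff _ (FaithfulSMul.algebraMap_injective K A)).1 hrem]
        simp
      · refine absurd ?_ (hxK (a⁻¹ * -b))
        rw [map_mul, map_neg, ← eq_neg_of_add_eq_zero_left hrem, ← mul_assoc, ← map_mul,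
          inv_mul_cancel₀ ha, map_one, one_mul]
    obtain ⟨Q', hQ'⟩ := IsIntegrallyClosed.eq_map_mul_C_of_dvd K hP hdvd
    rw [hQm.leadingCoeff, map_one, mul_one] at hQ'
    have ht : algebraMap R K (-Q'.coeff 1) = t := by
      rw [map_neg, ← Polynomial.coeff_map, hQ', hQ]; simp [Polynomial.coeff_C]
    have hn : algebraMap R K (Q'.coeff 0) = n := by
      rw [← Polynomial.coeff_map, hQ', hQ]; simp
    refine ⟨-Q'.coeff 1, Q'.coeff 0, ?_⟩
    rw [ht, hn]
    exact trace_norm_of_quadratic hA h4 hc hxK h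

/-- In a division algebra, an element with integral norm has integral trace, if the polynomials
`Y² - Y + c` with `v c < 1` have roots. -/
lemma valuation_le_one_of_quadratic {Γ₀ : Type*} [LinearOrderedCommGroupWithZero Γ₀]
    (v : Valuation K Γ₀) (hv : ∀ c, v c < 1 → ∃ y, y * y - y + c = 0) {x : A} {t n : K}
    (hx : ∀ c : K, algebraMap K A c ≠ x) (h : x * x = t • x - algebraMap K A n)
    (hn : v n ≤ 1) : v t ≤ 1 := by
  by_contra! ht
  have ht0 : t ≠ 0 := by rintro rfl; simp at ht
  -- Putting `X = t Y` turns `X² - t X + n` into `t² (Y² - Y + n / t²)`. For `v t > 1` the constant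
  -- term is small, so there is a root in `K`; the quadratic then splits over `K`, which a division
  -- algebra allows only for scalar `x`.
  have hlt : v (n / t ^ 2) < 1 := by
    have ht2 : 1 < v t ^ 2 := one_lt_pow₀ ht two_ne_zero
    rw [map_div₀, map_pow, div_lt_one₀ (zero_lt_one.trans ht2)]
    exact hn.trans_lt ht2
  obtain ⟨y, hy⟩ := hv _ hlt
  have hroot : (t * y) * (t * y) - t * (t * y) + n = 0 := by
    have : (t * y) * (t * y) - t * (t * y) + n = t ^ 2 * (y * y - y + n / t ^ 2) := by
      field_simp
    rw [this, hy, mul_zero]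
  have hfac : (x - algebraMap K A (t * y)) * (x - algebraMap K A (t - t * y)) = 0 := by
    have e : algebraMap K A (t * y) * algebraMap K A (t - t * y) = algebraMap K A n := by
      rw [← map_mul]; congr 1; linear_combination -hroot
    rw [sub_mul, mul_sub, mul_sub, e, h, ← Algebra.commutes (t - t * y) x, Algebra.smul_def, map_sub]
    noncomm_ring
  obtain ⟨z, -, hz⟩ := exists_mul_eq_one_of_isUnit (hA _ (sub_ne_zero.2 (hx (t * y)).symm))
  have := congrArg (z * ·) hfac
  simp only [← mul_assoc, hz, one_mul, mul_zero] at this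
  exact hx _ (sub_eq_zero.1 this).symm

/-- This is the ultrametric inequality after division by the larger element. If `x` has quadratic
polynomial `X² - t X + n`, that of `1 + x` has constant term `n + t + 1`, and integrality of `n`
forces that of `t`. -/
lemma norm_one_add_le_one {Γ₀ : Type*} [LinearOrderedCommGroupWithZero Γ₀]
    (v : Valuation K Γ₀) (hv : ∀ c, v c < 1 → ∃ y, y * y - y + c = 0) {x : A}
    (h : v (Algebra.norm K x) ≤ 1) : v (Algebra.norm K (1 + x)) ≤ 1 := by
  by_cases hx : ∃ c : K, algebraMap K A c = x
  · obtain ⟨c, rfl⟩ := hx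
    rw [norm_algebraMap_of_finrank_four h4, map_pow] at h
    rw [← map_one (algebraMap K A), ← map_add, norm_algebraMap_of_finrank_four h4, map_pow]
    have hc1 : v c ≤ 1 := (pow_le_one_iff_of_nonneg zero_le four_ne_zero).1 h
    exact pow_le_one' ((v.map_add 1 c).trans (by simp [hc1])) 4
  · push Not at hx
    obtain ⟨t, n, hq⟩ := exists_quadratic hA h4 hc x
    have hN := (trace_norm_of_quadratic hA h4 hc hx hq).2
    have hn : v n ≤ 1 := by
      have h1 := congrArg v hN
      rw [map_pow, map_pow] at h1
      exact (pow_le_one_iff_of_nonneg zero_le four_ne_zero).1 (h1 ▸ pow_le_one' h 2)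
    have ht := valuation_le_one_of_quadratic hA h4 hc v hv hx hq hn
    have hx' : ∀ c : K, algebraMap K A c ≠ 1 + x := fun c hcx =>
      hx (c - 1) (by rw [map_sub, hcx, map_one, add_sub_cancel_left])
    have hq' : (1 + x) * (1 + x) = (t + 1 + 1) • (1 + x) - algebraMap K A (n + t + 1) := by
      rw [mul_add, add_mul, add_mul, hq, Algebra.smul_def, Algebra.smul_def]
      simp only [map_add, map_one]
      noncomm_ring
    have hN' := congrArg v (trace_norm_of_quadratic hA h4 hc hx' hq').2
    rw [map_pow, map_pow] at hN'
    have hn' : v (n + t + 1) ≤ 1 := by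
      refine (v.map_add _ _).trans (max_le ((v.map_add _ _).trans (max_le hn ht)) (by simp))
    exact (pow_le_one_iff_of_nonneg zero_le two_ne_zero).1 (hN' ▸ pow_le_one' hn' 4)

/-- The valuation `v ∘ N` of a central division algebra of dimension four over a henselian valued
field, where `N` is the norm of the regular representation. -/
def normValuation {Γ₀ : Type*} [LinearOrderedCommGroupWithZero Γ₀]
    (v : Valuation K Γ₀) (hv : ∀ c, v c < 1 → ∃ y, y * y - y + c = 0) : Valuation A Γ₀ where
  toFun x := v (Algebra.norm K x)
  map_zero' := by
    have : Module.Finite K A := Module.finite_of_finrank_pos (by omega)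
    have : Nontrivial A := Module.nontrivial_of_finrank_pos (R := K) (by omega)
    rw [Algebra.norm_zero, map_zero]
  map_one' := by rw [map_one, map_one]
  map_mul' x y := by rw [map_mul, map_mul]
  map_add_le_max' := by
    -- With `y = u` a unit, `x + u = (1 + x u⁻¹) u` reduces the claim to `norm_one_add_le_one`.
    have key : ∀ x y : A, v (Algebra.norm K x) ≤ v (Algebra.norm K y) →
        v (Algebra.norm K (x + y)) ≤ v (Algebra.norm K y) := by
      intro x y hxy
      by_cases hy : y = 0
      · subst hy
        have : Module.Finite K A := Module.finite_of_finrank_pos (by omega)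
        have : Nontrivial A := Module.nontrivial_of_finrank_pos (R := K) (by omega)
        rw [Algebra.norm_zero, map_zero] at hxy
        have hN : Algebra.norm K x = 0 := by simpa using hxy
        have hx : x = 0 := by
          by_contra hx
          exact (((hA x hx).map (Algebra.norm K)).ne_zero) hN
        rw [hx, add_zero]
      · obtain ⟨u, rfl⟩ := hA y hy
        have hu : v (Algebra.norm K (u : A)) * v (Algebra.norm K ((u⁻¹ : Aˣ) : A)) = 1 := by
          rw [← map_mul, ← map_mul, Units.mul_inv, map_one, map_one]
        have h1 : v (Algebra.norm K (x * (u⁻¹ : Aˣ))) ≤ 1 := by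
          rw [map_mul, map_mul, ← hu]
          gcongr
        have h2 := norm_one_add_le_one hA h4 hc v hv h1
        have h3 : x + u = (1 + x * (u⁻¹ : Aˣ)) * u := by
          rw [add_mul, one_mul, mul_assoc, Units.inv_mul, mul_one, add_comm]
        rw [h3, map_mul, map_mul]
        exact mul_le_of_le_one_left' h2
    intro x y
    rcases le_total (v (Algebra.norm K x)) (v (Algebra.norm K y)) with h | h
    · exact (key x y h).trans (le_max_right _ _)
    · rw [add_comm]; exact (key y x h).trans (le_max_left _ _)

lemma normValuation_apply {Γ₀ : Type*} [LinearOrderedCommGroupWithZero Γ₀]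
    (v : Valuation K Γ₀) (hv : ∀ c, v c < 1 → ∃ y, y * y - y + c = 0) (x : A) :
    normValuation hA h4 hc v hv x = v (Algebra.norm K x) := rfl

lemma normValuation_algebraMap {Γ₀ : Type*} [LinearOrderedCommGroupWithZero Γ₀]
    (v : Valuation K Γ₀) (hv : ∀ c, v c < 1 → ∃ y, y * y - y + c = 0) (c : K) :
    normValuation hA h4 hc v hv (algebraMap K A c) = v c ^ 4 := by
  rw [normValuation_apply, norm_algebraMap_of_finrank_four h4, map_pow]

/-- The relation `N(x)² = n ^ 4` bounds `n`, and then Hensel's lemma bounds `t`. The quadratic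
relation is needed for reduction to the residue field, the trace for the finiteness of the enlarged
order. -/
lemma exists_quadratic_of_normValuation_le_one {Γ₀ : Type*} [LinearOrderedCommGroupWithZero Γ₀]
    (v : Valuation K Γ₀) (hv : ∀ c, v c < 1 → ∃ y, y * y - y + c = 0) {x : A}
    (h : normValuation hA h4 hc v hv x ≤ 1) :
    ∃ t n : K, v t ≤ 1 ∧ v n ≤ 1 ∧ x * x = t • x - algebraMap K A n ∧
      2 * LinearMap.trace K A (Algebra.lmul K A x) = 4 * t := by
  by_cases hx : ∃ c : K, algebraMap K A c = x
  · obtain ⟨c, rfl⟩ := hx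
    rw [normValuation_algebraMap] at h
    have hc1 : v c ≤ 1 := (pow_le_one_iff_of_nonneg zero_le four_ne_zero).1 h
    refine ⟨2 * c, c ^ 2, ?_, ?_, algebraMap_mul_self c, ?_⟩
    · rw [two_mul]; exact (v.map_add c c).trans (by simp [hc1])
    · rw [map_pow]; exact pow_le_one' hc1 2
    · rw [trace_lmul_algebraMap h4]; ring
  · push Not at hx
    obtain ⟨t, n, hq⟩ := exists_quadratic hA h4 hc x
    have hN := trace_norm_of_quadratic hA h4 hc hx hq
    have hn : v n ≤ 1 := by
      have h1 := congrArg v hN.2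
      rw [map_pow, map_pow] at h1
      rw [normValuation_apply] at h
      exact (pow_le_one_iff_of_nonneg zero_le four_ne_zero).1 (h1 ▸ pow_le_one' h 2)
    exact ⟨t, n, valuation_le_one_of_quadratic hA h4 hc v hv hx hq hn, hn, hq, hN.1⟩

/-- Elements that are integral over a subring of the valuation ring of `K` are in the valuation
ring of `A`. -/
lemma normValuation_le_one_of_isIntegral {Γ₀ : Type*} [LinearOrderedCommGroupWithZero Γ₀]
    (v : Valuation K Γ₀) (hv : ∀ c, v c < 1 → ∃ y, y * y - y + c = 0) {R : Type*} [CommRing R]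
    [Algebra R A] (hR : ∀ r : R, ∃ c : K, v c ≤ 1 ∧ algebraMap K A c = algebraMap R A r) {x : A}
    (hx : IsIntegral R x) : normValuation hA h4 hc v hv x ≤ 1 := by
  set w := normValuation hA h4 hc v hv
  obtain ⟨P, hP, hPx⟩ := hx
  by_contra! h
  have hwr : ∀ r, w (algebraMap R A r) ≤ 1 := fun r => by
    obtain ⟨c, hc1, hcr⟩ := hR r
    rw [← hcr, normValuation_algebraMap]
    exact pow_le_one' hc1 4
  -- If `w x > 1`, the leading term of a monic polynomial at `x` strictly dominates all the others,
  -- so the value cannot be `0`.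
  have hlt : ∀ Q : R[X], ∀ m, Q.natDegree ≤ m → w (Polynomial.aeval x Q) ≤ w x ^ m := by
    intro Q m hm
    rw [Polynomial.aeval_eq_sum_range]
    refine w.map_sum_le fun i hi => ?_
    rw [Algebra.smul_def, map_mul, map_pow]
    refine (mul_le_of_le_one_left' (hwr _)).trans ?_
    refine pow_le_pow_right' h.le ?_
    have := Finset.mem_range.1 hi
    omega
  have hP0 : Polynomial.aeval x P = 0 := hPx
  have hdeg : P.natDegree ≠ 0 := by
    intro h0
    rw [hP.natDegree_eq_zero.1 h0, map_one] at hP0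
    have := congrArg w hP0
    simp at this
  have hsplit := P.eraseLead_add_C_mul_X_pow
  rw [hP.leadingCoeff, map_one, one_mul] at hsplit
  rw [← hsplit, map_add, map_pow, Polynomial.aeval_X] at hP0
  have h1 := congrArg w (eq_neg_of_add_eq_zero_right hP0)
  rw [Valuation.map_neg, map_pow] at h1
  have h2 := hlt P.eraseLead _ P.eraseLead_natDegree_le
  rw [← h1] at h2
  exact absurd h2 (not_le.2 (pow_lt_pow_right₀ h (by omega)))

end DivisionAlgebra

/-! ### Conjugation on the residue field of a valued division algebra -/

section Residue

variable {K A Γ₀ : Type*} [Field K] [Ring A] [Algebra K A] [LinearOrderedCommGroupWithZero Γ₀]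

/-- The maximal ideal of the valuation ring of `A`. -/
def residueIdeal (w : Valuation A Γ₀) : Ideal w.integer where
  carrier := {x | w x < 1}
  zero_mem' := by simp
  add_mem' := fun {a b} ha hb => (w.map_add a b).trans_lt (max_lt ha hb)
  smul_mem' := fun c x hx => by
    change w ((c : A) * x) < 1
    rw [map_mul]
    exact (mul_le_of_le_one_left' c.2).trans_lt hx

instance (w : Valuation A Γ₀) : (residueIdeal w).IsTwoSided where
  mul_mem_of_left := fun {a} b ha => by
    change w ((a : A) * b) < 1
    rw [map_mul]
    exact mul_lt_one_of_lt_of_le ha b.2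

/-- Suppose that the residue ring of `A` is finite, and that the elements of `A` are roots of
quadratic polynomials over `K`. Then some inner automorphism of `A` induces the Frobenius
`x ↦ x ^ q` on the residue ring, where `q` is such that this map is the identity on the image
of `K`. -/
lemma exists_conj_sub_pow_lt_one (hA : ∀ x : A, x ≠ 0 → IsUnit x)
    (hc : ∀ x : A, (∀ y, x * y = y * x) → ∃ c : K, algebraMap K A c = x)
    (w : Valuation A Γ₀) (T : Set A) (hT : T.Finite)
    (hwT : ∀ x, w x ≤ 1 → ∃ t ∈ T, w (x - t) < 1)
    (hquad : ∀ x, w x ≤ 1 → ∃ t n : K, w (algebraMap K A t) ≤ 1 ∧ w (algebraMap K A n) ≤ 1 ∧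
      x * x = t • x - algebraMap K A n)
    {p f : ℕ} (hp : p.Prime) (hwp : w (p : A) < 1)
    (hq : ∀ c : K, w (algebraMap K A c) ≤ 1 →
      w (algebraMap K A c ^ p ^ f - algebraMap K A c) < 1) :
    ∃ a : Aˣ, ∀ x : A, w x ≤ 1 → w (a * x * (a⁻¹ : Aˣ) - x ^ p ^ f) < 1 := by
  set κ := w.integer ⧸ residueIdeal w
  let red : w.integer →+* κ := Ideal.Quotient.mk (residueIdeal w)
  have hred : ∀ x y : w.integer, red x = red y ↔ w ((x : A) - y) < 1 := fun x y =>
    Ideal.Quotient.mk_eq_mk_iff_sub_mem x y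
  have hred0 : ∀ x : w.integer, red x = 0 ↔ w (x : A) < 1 := fun x =>
    Ideal.Quotient.eq_zero_iff_mem
  have hsurj : Function.Surjective red := Ideal.Quotient.mk_surjective
  have : Nontrivial κ := by
    refine ⟨red 1, red 0, ?_⟩
    rw [Ne, hred]; simp
  -- Elements of `A` with the same approximant in `T` have the same residue, so the residue ring
  -- injects into `T`.
  have hfin : Finite κ := by
    have : Finite T := hT
    choose! τ hτ using hwT
    refine Finite.of_injective (fun x : κ => (⟨τ (Function.surjInv hsurj x).1,
      (hτ _ (Function.surjInv hsurj x).2).1⟩ : T)) ?_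
    intro x y hxy
    have h : τ (Function.surjInv hsurj x).1 = τ (Function.surjInv hsurj y).1 :=
      congrArg Subtype.val hxy
    rw [← Function.surjInv_eq hsurj x, ← Function.surjInv_eq hsurj y, hred]
    have h1 := (hτ _ (Function.surjInv hsurj x).2).2
    have h2 := (hτ _ (Function.surjInv hsurj y).2).2
    rw [← h] at h2
    have := w.map_sub_lt h1 h2
    rwa [sub_sub_sub_cancel_right] at this
  have hunit : ∀ x : κ, IsUnit x ∨ x = 0 := by
    intro x
    obtain ⟨x, rfl⟩ := hsurj x
    rcases x.2.lt_or_eq with h | h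
    · exact Or.inr ((hred0 x).2 h)
    · left
      obtain ⟨y, hy, hy'⟩ := exists_mul_eq_one_of_isUnit (hA x.1 (by
        intro h0; simp [h0] at h))
      have hwy : w y = 1 := by
        have := congrArg w hy
        rwa [map_mul, h, one_mul, map_one] at this
      let y' : w.integer := ⟨y, hwy.le⟩
      refine isUnit_iff_exists.2 ⟨red y', ?_, ?_⟩
      · rw [← map_mul, ← map_one red]; congr 1; exact Subtype.ext hy
      · rw [← map_mul, ← map_one red]; congr 1; exact Subtype.ext hy'
  -- The residue ring is a finite division ring, hence a field by Wedderburn's theorem, and its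
  -- multiplicative group is cyclic.
  let : DivisionRing κ := DivisionRing.ofIsUnitOrEqZero hunit
  let : Field κ := littleWedderburn κ
  have hchar : CharP κ p := (CharP.charP_iff_prime_eq_zero hp).2 (by
    have h1 : red (p : w.integer) = (p : κ) := map_natCast red p
    rw [← h1, hred0]; simpa using hwp)
  have : Fact p.Prime := ⟨hp⟩
  obtain ⟨g, hg⟩ := IsCyclic.exists_generator (α := κˣ)
  have hgen : ∀ y : κ, y ≠ 0 → ∃ m : ℕ, (g : κ) ^ m = y := by
    intro y hy
    obtain ⟨m, hm⟩ := (mem_powers_iff_mem_zpowers.2 (hg (Units.mk0 y hy)))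
    exact ⟨m, by simpa using congrArg Units.val hm⟩
  obtain ⟨x, hx⟩ := hsurj g
  -- it suffices to conjugate the lift of a generator
  suffices H : ∃ a : Aˣ, w (a * x * (a⁻¹ : Aˣ) - x ^ p ^ f) < 1 by
    obtain ⟨a, ha⟩ := H
    refine ⟨a, fun y hy => ?_⟩
    have hconj : ∀ z : A, w (a * z * (a⁻¹ : Aˣ)) = w z := by
      intro z
      have h1 : w (a : A) * w ((a⁻¹ : Aˣ) : A) = 1 := by
        rw [← map_mul, Units.mul_inv, map_one]
      rw [map_mul, map_mul, mul_right_comm, h1, one_mul]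
    let cj : w.integer → w.integer := fun z => ⟨a * z * (a⁻¹ : Aˣ), by
      rw [Valuation.mem_integer_iff, hconj]; exact z.2⟩
    have hcj : ∀ z : w.integer, red (cj z) = red z ^ p ^ f ↔
        w (a * z * (a⁻¹ : Aˣ) - (z : A) ^ p ^ f) < 1 := by
      intro z
      rw [← map_pow, hred]; rfl
    have hcjx : red (cj x) = red x ^ p ^ f := (hcj x).2 ha
    refine (hcj ⟨y, hy⟩).1 ?_
    generalize (⟨y, hy⟩ : w.integer) = z
    have hpow : ∀ m, cj (x ^ m) = cj x ^ m := by
      intro m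
      ext
      change (a : A) * (x : A) ^ m * (a⁻¹ : Aˣ) = ((a : A) * x * (a⁻¹ : Aˣ)) ^ m
      rw [Units.conj_pow]
    have hcongr : ∀ z z', red z = red z' → red (cj z) = red (cj z') := by
      intro z z' h
      rw [hred] at h ⊢
      change w (a * z * (a⁻¹ : Aˣ) - a * z' * (a⁻¹ : Aˣ)) < 1
      rwa [← sub_mul, ← mul_sub, hconj]
    -- Conjugation and the `q`-th power are both multiplicative on residues, and every nonzero
    -- residue is a power of `g`, so agreement at `g` suffices.
    by_cases hz : red z = 0
    · have h0 : cj 0 = 0 := by ext; simp [cj]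
      rw [hz, hcongr z 0 (by rw [hz, map_zero]), h0, map_zero,
        zero_pow (pow_ne_zero _ hp.ne_zero)]
    · obtain ⟨m, hm⟩ := hgen _ hz
      rw [← hm, hcongr z (x ^ m) (by rw [map_pow, hx, hm]), hpow, map_pow, hcjx, hx]
      ring
  -- If Frobenius fixes the generator it is trivial on the whole residue field, and `a = 1` serves.
  -- The degree of the residue field therefore never has to be computed.
  by_cases hfix : (g : κ) ^ p ^ f = g
  · refine ⟨1, ?_⟩
    have : red x = red (x ^ p ^ f) := by rw [map_pow, hx, hfix]
    rw [hred] at this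
    simpa using this
  · have hxK : ∀ c : K, algebraMap K A c ≠ x := by
      intro c hcx
      have h1 := hq c (by rw [hcx]; exact x.2)
      rw [hcx] at h1
      have h2 : red (x ^ p ^ f) = red x := (hred _ _).2 h1
      rw [map_pow, hx] at h2
      exact hfix h2
    obtain ⟨t, n, ht, hn, hxx⟩ := hquad x x.2
    obtain ⟨a, ha⟩ := exists_conj_eq hA hc hxK hxx
    refine ⟨a, ?_⟩
    let t' : w.integer := ⟨algebraMap K A t, ht⟩
    let n' : w.integer := ⟨algebraMap K A n, hn⟩
    have e1 : red x * red x = red t' * red x - red n' := by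
      rw [← map_mul, ← map_mul, ← map_sub]
      congr 1
      ext
      change (x : A) * x = algebraMap K A t * x - algebraMap K A n
      rw [hxx, Algebra.smul_def]
    have e2 : red t' ^ p ^ f = red t' := by
      rw [← map_pow, hred]; exact hq t ht
    have e3 : red n' ^ p ^ f = red n' := by
      rw [← map_pow, hred]; exact hq n hn
    -- The coefficients of the reduced quadratic are fixed by Frobenius, so `g ^ q` is a root of it
    -- along with `g`. Its roots are `g` and `t - g`; since `g ^ q ≠ g`, it is the residue of `t -
    -- x`, which is the conjugate of `x` by `a`.
    have e4 : red x ^ p ^ f * red x ^ p ^ f = red t' * red x ^ p ^ f - red n' := by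
      have := congrArg (· ^ p ^ f) e1
      simp only [sub_pow_char_pow, mul_pow, e2, e3] at this
      exact this
    have e5 : (red x ^ p ^ f - red x) * (red x ^ p ^ f - (red t' - red x)) = 0 := by
      linear_combination e4 - e1
    have e6 : red (t' - x) = red (x ^ p ^ f) := by
      rw [map_sub, map_pow]
      refine (sub_eq_zero.1 ((mul_eq_zero.1 e5).resolve_left ?_)).symm
      rw [hx]; exact sub_ne_zero.2 hfix
    rw [ha]
    exact (hred _ _).1 e6

end Residue

/-! ### Completions of number fields -/

section Completion

/-- Hensel's lemma for the polynomials `Y² - Y + c`. -/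
lemma exists_root_of_norm_lt_one {k : Type*} [NormedField k] [IsUltrametricDist k]
    [CompleteSpace k] {c : k} (hc : ‖c‖ < 1) : ∃ y, y * y - y + c = 0 := by
  -- A root is a fixed point of `z ↦ c + z²`. On the ball of radius `‖c‖` this map is a contraction
  -- with ratio `‖c‖`, because `z² - z'² = (z + z') (z - z')`.
  let y : ℕ → k := fun n => Nat.rec 0 (fun _ z => c + z * z) n
  have hy : ∀ n, y (n + 1) = c + y n * y n := fun _ => rfl
  have hle : ∀ n, ‖y n‖ ≤ ‖c‖ := by
    intro n
    induction n with
    | zero => change ‖(0 : k)‖ ≤ _; simp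
    | succ n ih =>
      rw [hy]
      refine (IsUltrametricDist.norm_add_le_max _ _).trans (max_le le_rfl ?_)
      rw [norm_mul]
      nlinarith [norm_nonneg (y n), norm_nonneg c]
  have hdist : ∀ n, dist (y n) (y (n + 1)) ≤ ‖c‖ * ‖c‖ ^ n := by
    intro n
    induction n with
    | zero =>
      rw [dist_eq_norm, hy]
      change ‖(0 : k) - (c + 0 * 0)‖ ≤ _
      simp
    | succ n ih =>
      rw [dist_eq_norm] at ih ⊢
      have e : y (n + 1) - y (n + 1 + 1) = (y n + y (n + 1)) * (y n - y (n + 1)) := by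
        rw [hy (n + 1), hy n]; ring
      have h1 : ‖y n + y (n + 1)‖ ≤ ‖c‖ :=
        (IsUltrametricDist.norm_add_le_max _ _).trans (max_le (hle n) (hle (n + 1)))
      rw [e, norm_mul, pow_succ']
      exact mul_le_mul h1 ih (norm_nonneg _) (norm_nonneg _)
  obtain ⟨z, hz⟩ := cauchySeq_tendsto_of_complete (cauchySeq_of_le_geometric _ _ hc hdist)
  have h1 : Filter.Tendsto (fun n => y (n + 1)) Filter.atTop (nhds z) :=
    hz.comp (Filter.tendsto_add_atTop_nat 1)
  have h2 : Filter.Tendsto (fun n => y (n + 1)) Filter.atTop (nhds (c + z * z)) := by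
    simp only [hy]
    exact tendsto_const_nhds.add (hz.mul hz)
  have := tendsto_nhds_unique h1 h2
  exact ⟨z, by linear_combination -this⟩

variable {F : Type u} [Field F] [NumberField F] (v : HeightOneSpectrum (𝓞 F))

lemma exists_root_adicCompletion (c : v.adicCompletion F) (hc : Valued.v c < 1) :
    ∃ y, y * y - y + c = 0 :=
  exists_root_of_norm_lt_one (Valued.toNormedField.norm_lt_one_iff.2 hc)

lemma exists_sub_lt_one (x : v.adicCompletion F) :
    ∃ f : F, Valued.v (x - algebraMap F (v.adicCompletion F) f) < 1 := by
  have hopen : {y : v.adicCompletion F | Valued.v (x - y) < 1} ∈ nhds x := by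
    have h := Metric.ball_mem_nhds x one_pos
    refine Filter.mem_of_superset h fun y hy => ?_
    rw [Metric.mem_ball, dist_comm, dist_eq_norm] at hy
    exact Valued.toNormedField.norm_lt_one_iff.1 hy
  obtain ⟨_, h, f, rfl⟩ := mem_closure_iff_nhds.1
    ((HeightOneSpectrum.denseRange_algebraMap F v) x) _ hopen
  exact ⟨f, h⟩

lemma valued_algebraMap (f : F) :
    Valued.v (algebraMap F (v.adicCompletion F) f) = v.valuation F f :=
  HeightOneSpectrum.valuedAdicCompletion_eq_valuation' v f

lemma valued_algebraMap_int (r : 𝓞 F) :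
    Valued.v (algebraMap F (v.adicCompletion F) (algebraMap (𝓞 F) F r)) = v.intValuation r := by
  rw [valued_algebraMap, HeightOneSpectrum.valuation_of_algebraMap]

lemma exists_int_sub_lt_one (x : v.adicCompletion F) (hx : Valued.v x ≤ 1) :
    ∃ r : 𝓞 F, Valued.v (x - algebraMap F (v.adicCompletion F) (algebraMap (𝓞 F) F r)) < 1 := by
  obtain ⟨f, hf⟩ := exists_sub_lt_one v x
  have hf1 : v.valuation F f ≤ 1 := by
    rw [← valued_algebraMap]
    have : algebraMap F (v.adicCompletion F) f =
      x - (x - algebraMap F (v.adicCompletion F) f) := by ring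
    rw [this]
    exact (Valuation.map_sub _ _ _).trans (max_le hx hf.le)
  obtain ⟨r, hr⟩ := v.exists_valuation_sub_lt_of_integer (K := F) hf1 (γ := 1)
  refine ⟨r, ?_⟩
  rw [Units.val_one, Valuation.map_sub_swap, ← valued_algebraMap, map_sub] at hr
  rw [← sub_add_sub_cancel]
  exact Valuation.map_add_lt _ hf hr

/-- Modulo the maximal ideal an integral `x` may be replaced by an element of `𝓞 F`, where the claim
is Fermat's identity in the finite field `𝓞 F ⧸ v`. -/
lemma valued_pow_card_sub_lt_one (x : v.adicCompletion F) (hx : Valued.v x ≤ 1) :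
    Valued.v (x ^ Nat.card (𝓞 F ⧸ v.asIdeal) - x) < 1 := by
  obtain ⟨r, hr⟩ := exists_int_sub_lt_one v x hx
  set q := Nat.card (𝓞 F ⧸ v.asIdeal)
  set y := algebraMap F (v.adicCompletion F) (algebraMap (𝓞 F) F r) with hy
  have hy1 : Valued.v y ≤ 1 := by
    rw [hy, valued_algebraMap_int]; exact v.intValuation_le_one r
  have h1 : Valued.v (x ^ q - y ^ q) < 1 := by
    obtain ⟨z, hz⟩ := sub_dvd_pow_sub_pow (⟨x, hx⟩ : v.adicCompletionIntegers F) ⟨y, hy1⟩ q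
    have : x ^ q - y ^ q = (x - y) * z := congrArg Subtype.val hz
    rw [this, map_mul]
    exact (mul_le_of_le_one_right' z.2).trans_lt hr
  have h2 : Valued.v (y ^ q - y) < 1 := by
    have : y ^ q - y = algebraMap F (v.adicCompletion F) (algebraMap (𝓞 F) F (r ^ q - r)) := by
      simp [hy]
    rw [this, valued_algebraMap_int, HeightOneSpectrum.intValuation_lt_one_iff_mem,
      ← Ideal.Quotient.eq_zero_iff_mem, map_sub, map_pow]
    have : Finite (𝓞 F ⧸ v.asIdeal) := v.asIdeal.finiteQuotientOfFreeOfNeBot v.ne_bot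
    have := Fintype.ofFinite (𝓞 F ⧸ v.asIdeal)
    have hm : v.asIdeal.IsMaximal := v.isMaximal
    let _ : Field (𝓞 F ⧸ v.asIdeal) := Ideal.Quotient.field _
    rw [sub_eq_zero, show q = _ from Nat.card_eq_fintype_card]
    exact FiniteField.pow_card _
  have : x ^ q - x = (x ^ q - y ^ q) + ((y ^ q - y) - (x - y)) := by ring
  rw [this]
  exact Valuation.map_add_lt _ h1 (Valuation.map_sub_lt _ h2 hr)

lemma exists_card_eq_pow {p : ℕ} [hp : Fact p.Prime] (hpv : (p : 𝓞 F) ∈ v.asIdeal) :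
    ∃ f : ℕ, Nat.card (𝓞 F ⧸ v.asIdeal) = p ^ f := by
  have : Finite (𝓞 F ⧸ v.asIdeal) := v.asIdeal.finiteQuotientOfFreeOfNeBot v.ne_bot
  have := Fintype.ofFinite (𝓞 F ⧸ v.asIdeal)
  have hm : v.asIdeal.IsMaximal := v.isMaximal
  let _ : Field (𝓞 F ⧸ v.asIdeal) := Ideal.Quotient.field _
  have : CharP (𝓞 F ⧸ v.asIdeal) p := (CharP.charP_iff_prime_eq_zero hp.out).2 (by
    rw [← map_natCast (Ideal.Quotient.mk v.asIdeal)]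
    exact Ideal.Quotient.eq_zero_iff_mem.2 hpv)
  obtain ⟨n, -, hn⟩ := FiniteField.card (𝓞 F ⧸ v.asIdeal) p
  exact ⟨n, by rw [Nat.card_eq_fintype_card, hn]⟩

/-- Write `f = c / b` and `(b) = v ^ n J` with `v ∤ J`. Any `s ∈ J` outside `v` clears the part of
the denominator prime to `v`, and `v ^ n` clears the rest. -/
lemma exists_notMem_forall_mem_pow (f : F) : ∃ s : 𝓞 F, s ∉ v.asIdeal ∧ ∃ n : ℕ,
    ∀ a ∈ v.asIdeal ^ n, ∃ r : 𝓞 F, algebraMap (𝓞 F) F r = algebraMap (𝓞 F) F (a * s) * f := by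
  obtain ⟨c, b, hb, rfl⟩ := IsFractionRing.div_surjective (A := 𝓞 F) f
  have hb0 : b ≠ 0 := nonZeroDivisors.ne_zero hb
  have hI : Ideal.span {b} ≠ (0 : Ideal (𝓞 F)) := by simpa using hb0
  obtain ⟨J, hJ, hvJ⟩ := (FiniteMultiplicity.of_prime_left v.prime hI).exists_eq_pow_mul_and_not_dvd
  obtain ⟨s, hsJ, hsv⟩ := SetLike.not_le_iff_exists.1 (fun h => hvJ (Ideal.dvd_iff_le.2 h))
  refine ⟨s, hsv, multiplicity v.asIdeal (Ideal.span {b}), fun a ha => ?_⟩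
  have : a * s ∈ Ideal.span {b} := hJ ▸ Ideal.mul_mem_mul ha hsJ
  obtain ⟨r, hr⟩ := Ideal.mem_span_singleton'.1 this
  refine ⟨r * c, ?_⟩
  have hbF : algebraMap (𝓞 F) F b ≠ 0 := by simpa using hb0
  rw [← hr]
  simp only [map_mul]
  field_simp

end Completion

/-! ### Maximal orders at the ramified places -/

section Ramified

variable {F : Type u} [Field F] [NumberField F] {D : Type u} [Ring D] [Algebra F D]
  {v : HeightOneSpectrum (𝓞 F)}

lemma finrank_localAlg (h4 : Module.finrank F D = 4) :
    Module.finrank (v.adicCompletion F) (LocalAlg F D v) = 4 := by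
  rw [Module.finrank_baseChange, h4]

/-- The centraliser of `D` in `F_v ⊗ D` is `F_v ⊗ Z(D)`, and `Z(D) = F`. -/
lemma localAlg_center [Algebra.IsCentral F D] (x : LocalAlg F D v) (hx : ∀ y, x * y = y * x) :
    ∃ c : v.adicCompletion F, algebraMap _ _ c = x := by
  have h1 : x ∈ Subalgebra.centralizer F
      (Algebra.TensorProduct.includeRight : D →ₐ[F] LocalAlg F D v).range := by
    rw [Subalgebra.mem_centralizer_iff]
    intro y _
    exact (hx y).symm
  rw [Subalgebra.centralizer_range_includeRight_eq_center_tensorProduct] at h1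
  obtain ⟨y, rfl⟩ := h1
  clear hx
  induction y using TensorProduct.induction_on with
  | zero => exact ⟨0, by simp⟩
  | add a b ha hb =>
    obtain ⟨c, hc⟩ := ha
    obtain ⟨e, he⟩ := hb
    exact ⟨c + e, by rw [map_add, map_add, hc, he]⟩
  | tmul a b =>
    obtain ⟨f, hf⟩ := Algebra.mem_bot.1 (Algebra.IsCentral.out b.2)
    refine ⟨f • a, ?_⟩
    change (f • a) ⊗ₜ[F] (1 : D) = a ⊗ₜ[F] (b : D)
    rw [← hf, Algebra.algebraMap_eq_smul_one, TensorProduct.tmul_smul, TensorProduct.smul_tmul']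

lemma tmul_injective : Function.Injective (fun d : D => (1 : v.adicCompletion F) ⊗ₜ[F] d) :=
  Algebra.TensorProduct.includeRight_injective (FaithfulSMul.algebraMap_injective _ _)

/-- `D` embeds in the division ring `D_v`, so it has no zero divisors, and being finite-dimensional
it is a division ring. Thus the results on quadratic relations apply to `D` over `F` as well as to
`D_v` over `F_v`. -/
lemma isUnit_of_isRamifiedAt (h4 : Module.finrank F D = 4) (hv : IsRamifiedAt F D v) (d : D)
    (hd : d ≠ 0) : IsUnit d := by
  have : Module.Finite F D := Module.finite_of_finrank_pos (by omega)
  have key : ∀ d : D, d ≠ 0 → ∃ e, d * e = 1 := by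
    intro d hd
    have hinj : Function.Injective (LinearMap.mulLeft F d) := by
      rw [← LinearMap.ker_eq_bot, LinearMap.ker_eq_bot']
      intro e he
      have h1 : (1 : v.adicCompletion F) ⊗ₜ[F] d ≠ 0 := fun h =>
        hd (tmul_injective (v := v) (by simpa using h))
      have h2 : ((1 : v.adicCompletion F) ⊗ₜ[F] d) * ((1 : v.adicCompletion F) ⊗ₜ[F] e) = 0 := by
        rw [Algebra.TensorProduct.tmul_mul_tmul, show d * e = 0 from he, TensorProduct.tmul_zero]
      exact tmul_injective (v := v) (by simpa using (hv _ h1).mul_right_eq_zero.1 h2)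
    exact LinearMap.surjective_of_injective hinj 1
  obtain ⟨e, he⟩ := key d hd
  obtain ⟨f, hf⟩ := key e (by
    rintro rfl
    rw [mul_zero] at he
    exact hd (by rw [← mul_one d, ← he, mul_zero]))
  have : d = f := by rw [← mul_one d, ← hf, ← mul_assoc, he, one_mul]
  exact isUnit_iff_exists.2 ⟨e, he, this ▸ hf⟩

lemma trace_lmul_tmul [Module.Finite F D] (d : D) :
    LinearMap.trace (v.adicCompletion F) (LocalAlg F D v)
      (Algebra.lmul (v.adicCompletion F) (LocalAlg F D v) (1 ⊗ₜ[F] d)) =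
    algebraMap F (v.adicCompletion F) (LinearMap.trace F D (Algebra.lmul F D d)) := by
  rw [← LinearMap.trace_baseChange]
  congr 1
  ext e
  simp

lemma isIntegral_of_mem_order {O : Subalgebra (𝓞 F) D} (hO : IsOrder F D O) {d : D} (hd : d ∈ O) :
    IsIntegral (𝓞 F) d := IsIntegral.of_mem_of_fg O hO.1 d hd

variable [Algebra.IsCentral F D] (h4 : Module.finrank F D = 4) (hv : IsRamifiedAt F D v)

variable (D v) in
/-- The valuation of the division algebra `D_v`. -/
def localVal : Valuation (LocalAlg F D v) (WithZero (Multiplicative ℤ)) :=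
  normValuation hv (finrank_localAlg h4) localAlg_center Valued.v (exists_root_adicCompletion v)

lemma localVal_algebraMap (c : v.adicCompletion F) :
    localVal D v h4 hv (algebraMap _ _ c) = Valued.v c ^ 4 :=
  normValuation_algebraMap _ _ _ _ _ c

lemma localVal_smul (c : v.adicCompletion F) (x : LocalAlg F D v) :
    localVal D v h4 hv (c • x) = Valued.v c ^ 4 * localVal D v h4 hv x := by
  rw [Algebra.smul_def, map_mul, localVal_algebraMap]

lemma localVal_tmul_le_one {O : Subalgebra (𝓞 F) D} (hO : IsOrder F D O) {d : D} (hd : d ∈ O) :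
    localVal D v h4 hv (1 ⊗ₜ[F] d) ≤ 1 := by
  refine normValuation_le_one_of_isIntegral (R := 𝓞 F) _ _ _ _ _ (fun r => ?_) ?_
  · refine ⟨algebraMap F _ (algebraMap (𝓞 F) F r), ?_, rfl⟩
    rw [valued_algebraMap_int]
    exact v.intValuation_le_one r
  · refine (isIntegral_of_mem_order hO hd).map_of_comp_eq (RingHom.id (𝓞 F))
      (Algebra.TensorProduct.includeRight : D →ₐ[F] LocalAlg F D v).toRingHom ?_
    ext r
    exact ((Algebra.TensorProduct.includeRight : D →ₐ[F] LocalAlg F D v).commutes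
      (algebraMap (𝓞 F) F r)).symm

lemma localVal_le_one_of_mem_localOrder {O : Subalgebra (𝓞 F) D} (hO : IsOrder F D O)
    {x : LocalAlg F D v} (hx : x ∈ localOrder O v) : localVal D v h4 hv x ≤ 1 := by
  induction hx using Algebra.adjoin_induction with
  | mem x hx =>
    obtain ⟨d, hd, rfl⟩ := hx
    exact localVal_tmul_le_one h4 hv hO hd
  | algebraMap r =>
    rw [IsScalarTower.algebraMap_apply (v.adicCompletionIntegers F) (v.adicCompletion F),
      localVal_algebraMap]
    exact pow_le_one' r.2 4
  | add x y _ _ hx hy => exact (Valuation.map_add _ _ _).trans (max_le hx hy)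
  | mul x y _ _ hx hy => rw [map_mul]; exact mul_le_one' hx hy

variable (D v) in
/-- The elements of `D` that are integral at `v`, and in the given order at the other places. -/
def saturatedOrder (O : Subalgebra (𝓞 F) D) (hO : IsOrder F D O) : Subalgebra (𝓞 F) D where
  carrier := {d | localVal D v h4 hv (1 ⊗ₜ[F] d) ≤ 1 ∧ ∃ n : ℕ, ∀ a ∈ v.asIdeal ^ n, a • d ∈ O}
  mul_mem' := by
    rintro d e ⟨hd, n, hn⟩ ⟨he, m, hm⟩
    refine ⟨?_, n + m, fun a ha => ?_⟩
    · rw [← one_mul (1 : v.adicCompletion F), ← Algebra.TensorProduct.tmul_mul_tmul, map_mul]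
      exact mul_le_one' hd he
    · rw [pow_add] at ha
      induction ha using Submodule.mul_induction_on' with
      | mem_mul_mem a ha b hb =>
        rw [mul_smul_mul_comm]
        exact mul_mem (hn a ha) (hm b hb)
      | add a _ b _ ha hb => rw [add_smul]; exact add_mem ha hb
  add_mem' := by
    rintro d e ⟨hd, n, hn⟩ ⟨he, m, hm⟩
    refine ⟨?_, n + m, fun a ha => ?_⟩
    · rw [TensorProduct.tmul_add]
      exact (Valuation.map_add _ _ _).trans (max_le hd he)
    · rw [smul_add]
      exact add_mem (hn a (Ideal.pow_le_pow_right (Nat.le_add_right n m) ha))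
        (hm a (Ideal.pow_le_pow_right (Nat.le_add_left m n) ha))
  algebraMap_mem' r :=
    ⟨localVal_tmul_le_one h4 hv hO (O.algebraMap_mem r), 0, fun a _ =>
      O.smul_mem (O.algebraMap_mem r) a⟩

lemma le_saturatedOrder {O : Subalgebra (𝓞 F) D} (hO : IsOrder F D O) :
    O ≤ saturatedOrder D v h4 hv O hO := fun _ hd =>
  ⟨localVal_tmul_le_one h4 hv hO hd, 0, fun a _ => O.smul_mem hd a⟩

/-- Integrality of the trace is checked place by place: at `v` it comes from the valuation of `D_v`,
elsewhere from the original order. -/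
lemma trace_mem_of_mem_saturatedOrder {O : Subalgebra (𝓞 F) D} (hO : IsOrder F D O) {d : D}
    (hd : d ∈ saturatedOrder D v h4 hv O hO) :
    LinearMap.trace F D (Algebra.lmul F D d) ∈ (algebraMap (𝓞 F) F).range := by
  have : Module.Finite F D := Module.finite_of_finrank_pos (by omega)
  obtain ⟨hd1, n, hn⟩ := hd
  refine HeightOneSpectrum.mem_integers_of_valuation_le_one F _ fun u => ?_
  by_cases huv : u = v
  · subst huv
    obtain ⟨t, -, ht, -, -, htr⟩ := exists_quadratic_of_normValuation_le_one hv
      (finrank_localAlg h4) localAlg_center Valued.v (exists_root_adicCompletion u) hd1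
    have htr' : LinearMap.trace (u.adicCompletion F) (LocalAlg F D u)
      (Algebra.lmul (u.adicCompletion F) (LocalAlg F D u) (1 ⊗ₜ[F] d)) = t + t := by
      have : CharZero (u.adicCompletion F) :=
        charZero_of_injective_algebraMap (algebraMap F (u.adicCompletion F)).injective
      linear_combination htr / 2
    rw [← valued_algebraMap, ← trace_lmul_tmul, htr']
    exact (Valuation.map_add _ _ _).trans (max_le ht ht)
  -- Such an `a` is a unit at `u` and `a d` lies in the order, so the trace of `a d` is integral and
  -- division by `a` does no harm at `u`.
  · obtain ⟨a, ha, hau⟩ : ∃ a ∈ v.asIdeal ^ n, a ∉ u.asIdeal := by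
      by_contra! H
      have h1 : v.asIdeal ^ n ≤ u.asIdeal := H
      have h2 : v.asIdeal ≤ u.asIdeal := u.isPrime.le_of_pow_le h1
      exact huv (HeightOneSpectrum.ext (v.isMaximal.eq_of_le u.isPrime.ne_top h2).symm)
    have hcen : ∀ x : D, (∀ y, x * y = y * x) → ∃ c : F, algebraMap F D c = x := fun x hx =>
      Algebra.mem_bot.1 (Algebra.IsCentral.out (Subalgebra.mem_center_iff.2 fun y => (hx y).symm))
    obtain ⟨t, -, htr, -⟩ := exists_quadratic_of_isIntegral (isUnit_of_isRamifiedAt h4 hv) h4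
      hcen (isIntegral_of_mem_order hO (hn a ha))
    have htr' : algebraMap (𝓞 F) F a * LinearMap.trace F D (Algebra.lmul F D d) =
        algebraMap (𝓞 F) F (2 * t) := by
      rw [← algebraMap_smul F a d, map_smul, map_smul, smul_eq_mul] at htr
      rw [map_mul, map_ofNat]
      linear_combination htr / 2
    have h3 := congrArg (u.valuation F) htr'
    rw [map_mul, (u.valuation_eq_one_iff_notMem (K := F)).2 hau, one_mul] at h3
    rw [h3]
    exact u.valuation_le_one _

/-- Only finite generation is at stake. The enlarged ring pairs integrally with `O` under the trace
form, so it lies in the dual of the lattice spanned by an `F`-basis contained in `O`; this dual is a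
finitely generated module over a noetherian ring. -/
lemma isOrder_saturatedOrder {O : Subalgebra (𝓞 F) D} (hO : IsOrder F D O) :
    IsOrder F D (saturatedOrder D v h4 hv O hO) := by
  have : Module.Finite F D := Module.finite_of_finrank_pos (by omega)
  refine ⟨?_, top_le_iff.1 (hO.2 ▸ Submodule.span_mono (le_saturatedOrder h4 hv hO))⟩
  let b := Module.Basis.ofSpan hO.2.ge
  have hb : ∀ i, b i ∈ O := fun i => Module.Basis.ofSpan_subset hO.2.ge ⟨i, rfl⟩
  let T : LinearMap.BilinForm F D := (LinearMap.mul F D).compr₂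
    (LinearMap.trace F D ∘ₗ (Algebra.lmul F D).toLinearMap)
  -- A nonzero `x` pairs with its inverse to the trace of `1`, which is `4 ≠ 0`.
  have hT : T.Nondegenerate := by
    have h1 : LinearMap.trace F D (Algebra.lmul F D 1) ≠ 0 := by
      rw [map_one, LinearMap.trace_one, h4]; norm_num
    constructor
    · intro x hx
      by_contra hx0
      obtain ⟨y, hy, -⟩ := exists_mul_eq_one_of_isUnit (isUnit_of_isRamifiedAt h4 hv x hx0)
      exact h1 (hy ▸ hx y)
    · intro x hx
      by_contra hx0
      obtain ⟨y, -, hy⟩ := exists_mul_eq_one_of_isUnit (isUnit_of_isRamifiedAt h4 hv x hx0)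
      exact h1 (hy ▸ hx y)
  have hle : Subalgebra.toSubmodule (saturatedOrder D v h4 hv O hO) ≤
      T.dualSubmodule (Submodule.span (𝓞 F) (Set.range b)) := by
    intro d hd
    rw [LinearMap.BilinForm.mem_dualSubmodule]
    intro e he
    have heO : e ∈ O := by
      have : Submodule.span (𝓞 F) (Set.range b) ≤ Subalgebra.toSubmodule O :=
        Submodule.span_le.2 (by rintro _ ⟨i, rfl⟩; exact hb i)
      exact this he
    obtain ⟨r, hr⟩ := trace_mem_of_mem_saturatedOrder h4 hv hO
      (mul_mem hd (le_saturatedOrder h4 hv hO heO))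
    exact Submodule.mem_one.2 ⟨r, hr⟩
  rw [LinearMap.BilinForm.dualSubmodule_span_of_basis T hT] at hle
  have : Finite _ := Module.Finite.finite_basis b
  exact isNoetherian_submodule.1
    (isNoetherian_span_of_finite (𝓞 F) (Set.finite_range (T.dualBasis hT b))) _ hle

lemma saturatedOrder_eq {O : Subalgebra (𝓞 F) D} (hO : Maximal (IsOrder F D) O) :
    saturatedOrder D v h4 hv O hO.1 = O :=
  (hO.eq_of_le (isOrder_saturatedOrder h4 hv hO.1) (le_saturatedOrder h4 hv hO.1)).symm

lemma tmul_mem_localOrder {O : Subalgebra (𝓞 F) D} {d : D} (hd : d ∈ O) :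
    (1 : v.adicCompletion F) ⊗ₜ[F] d ∈ localOrder O v :=
  Algebra.subset_adjoin ⟨d, hd, rfl⟩

lemma smul_mem_localOrder {O : Subalgebra (𝓞 F) D} {c : v.adicCompletion F} (hc : Valued.v c ≤ 1)
    {x : LocalAlg F D v} (hx : x ∈ localOrder O v) : c • x ∈ localOrder O v :=
  (localOrder O v).smul_mem hx (⟨c, hc⟩ : v.adicCompletionIntegers F)

/-- `F` is dense in `F_v`, so coefficients can be moved into `F` at the cost of an integral multiple
of an element of the order. -/
lemma exists_sub_tmul_mem_localOrder {O : Subalgebra (𝓞 F) D} (hO : IsOrder F D O)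
    (x : LocalAlg F D v) : ∃ d : D, x - 1 ⊗ₜ[F] d ∈ localOrder O v := by
  have key : ∀ d ∈ Submodule.span F (O : Set D), ∀ c : v.adicCompletion F,
      ∃ e : D, c ⊗ₜ[F] d - 1 ⊗ₜ[F] e ∈ localOrder O v := by
    intro d hd
    induction hd using Submodule.span_induction with
    | mem d hd =>
      intro c
      obtain ⟨f, hf⟩ := exists_sub_lt_one v c
      refine ⟨f • d, ?_⟩
      have : c ⊗ₜ[F] d - 1 ⊗ₜ[F] (f • d) =
          (c - algebraMap F _ f) • ((1 : v.adicCompletion F) ⊗ₜ[F] d) := by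
        rw [TensorProduct.tmul_smul, TensorProduct.smul_tmul', TensorProduct.smul_tmul',
          smul_eq_mul, mul_one, TensorProduct.sub_tmul, Algebra.algebraMap_eq_smul_one]
      rw [this]
      exact smul_mem_localOrder hf.le (tmul_mem_localOrder hd)
    | zero => exact fun c => ⟨0, by simp⟩
    | add d d' _ _ h h' =>
      intro c
      obtain ⟨e, he⟩ := h c
      obtain ⟨e', he'⟩ := h' c
      refine ⟨e + e', ?_⟩
      rw [TensorProduct.tmul_add, TensorProduct.tmul_add, add_sub_add_comm]
      exact add_mem he he'
    | smul f d _ h =>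
      intro c
      obtain ⟨e, he⟩ := h (f • c)
      exact ⟨e, by rwa [← TensorProduct.smul_tmul]⟩
  induction x using TensorProduct.induction_on with
  | zero => exact ⟨0, by simp⟩
  | tmul c d => exact key d (hO.2 ▸ Submodule.mem_top) c
  | add x y hx hy =>
    obtain ⟨e, he⟩ := hx
    obtain ⟨e', he'⟩ := hy
    refine ⟨e + e', ?_⟩
    rw [TensorProduct.tmul_add, add_sub_add_comm]
    exact add_mem he he'

/-- The denominators of `d` with respect to `O` split into a factor `s` prime to `v` and a power of
`v`. The first is harmless in `D_v`, the second is what the definition of `saturatedOrder` permits.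
-/
lemma exists_smul_mem_order {O : Subalgebra (𝓞 F) D} (hO : IsOrder F D O) (d : D) :
    ∃ s : 𝓞 F, s ∉ v.asIdeal ∧ ∃ n : ℕ, ∀ a ∈ v.asIdeal ^ n, (a * s) • d ∈ O := by
  have hd : d ∈ Submodule.span F (O : Set D) := hO.2 ▸ Submodule.mem_top
  induction hd using Submodule.span_induction with
  | mem d hd =>
    exact ⟨1, v.isPrime.one_notMem, 0, fun a _ => O.smul_mem hd _⟩
  | zero => exact ⟨1, v.isPrime.one_notMem, 0, fun a _ => by simp⟩
  | add d d' _ _ h h' =>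
    obtain ⟨s, hs, n, hn⟩ := h
    obtain ⟨s', hs', n', hn'⟩ := h'
    refine ⟨s * s', fun H => (v.isPrime.mem_or_mem H).elim hs hs', n + n', fun a ha => ?_⟩
    rw [smul_add]
    refine add_mem ?_ ?_
    · rw [← mul_assoc, mul_comm, mul_smul]
      exact O.smul_mem (hn a (Ideal.pow_le_pow_right (Nat.le_add_right n n') ha)) _
    · rw [mul_left_comm, mul_smul]
      exact O.smul_mem (hn' a (Ideal.pow_le_pow_right (Nat.le_add_left n' n) ha)) _
  | smul f d _ h =>
    obtain ⟨s, hs, n, hn⟩ := h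
    obtain ⟨s', hs', n', hn'⟩ := exists_notMem_forall_mem_pow v f
    refine ⟨s * s', fun H => (v.isPrime.mem_or_mem H).elim hs hs', n + n', fun a ha => ?_⟩
    rw [pow_add] at ha
    induction ha using Submodule.mul_induction_on' with
    | mem_mul_mem a ha b hb =>
      obtain ⟨r, hr⟩ := hn' b hb
      have : (a * b * (s * s')) • f • d = r • ((a * s) • d) := by
        rw [← algebraMap_smul F r, ← algebraMap_smul F (a * s), ← algebraMap_smul F (_ * (s * s')),
          smul_smul, smul_smul, hr]
        congr 1
        simp only [map_mul]
        ring
      rw [this]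
      exact O.smul_mem (hn a ha) r
    | add a _ b _ ha hb => rw [add_mul, add_smul]; exact add_mem ha hb

/-- At a ramified place the completion of a maximal order is the valuation ring. -/
lemma mem_localOrder_iff {O : Subalgebra (𝓞 F) D} (hO : Maximal (IsOrder F D) O)
    {x : LocalAlg F D v} : x ∈ localOrder O v ↔ localVal D v h4 hv x ≤ 1 := by
  refine ⟨localVal_le_one_of_mem_localOrder h4 hv hO.1, fun hx => ?_⟩
  -- Modulo the local order `x` becomes a global `d`, still of valuation at most `1`. For a suitable
  -- `s` that is a unit at `v`, the multiple `s d` lies in the saturated order, which is `O` by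
  -- maximality; then `s` is divided out in `F_v`.
  obtain ⟨d, hd⟩ := exists_sub_tmul_mem_localOrder hO.1 x
  obtain ⟨s, hs, n, hn⟩ := exists_smul_mem_order (v := v) hO.1 d
  have hd1 : localVal D v h4 hv (1 ⊗ₜ[F] d) ≤ 1 := by
    rw [← sub_sub_cancel x (1 ⊗ₜ[F] d)]
    exact (Valuation.map_sub _ _ _).trans
      (max_le hx (localVal_le_one_of_mem_localOrder h4 hv hO.1 hd))
  set s' : v.adicCompletion F := algebraMap F _ (algebraMap (𝓞 F) F s) with hs'
  have hvs : Valued.v s' = 1 := by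
    rw [hs', valued_algebraMap]; exact (v.valuation_eq_one_iff_notMem (K := F)).2 hs
  have hs0 : s' ≠ 0 := by intro h; rw [h, map_zero] at hvs; exact zero_ne_one hvs
  have htm : (1 : v.adicCompletion F) ⊗ₜ[F] (s • d) = s' • (1 ⊗ₜ[F] d) := by
    rw [← algebraMap_smul F s d, TensorProduct.tmul_smul]
    exact (algebraMap_smul _ _ _).symm
  have hsd : s • d ∈ O := by
    rw [← saturatedOrder_eq h4 hv hO]
    refine ⟨?_, n, fun a ha => by rw [smul_smul]; exact hn a ha⟩
    rw [htm, localVal_smul, hvs, one_pow, one_mul]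
    exact hd1
  have h1 : (1 : v.adicCompletion F) ⊗ₜ[F] d ∈ localOrder O v := by
    have : (1 : v.adicCompletion F) ⊗ₜ[F] d = s'⁻¹ • (1 ⊗ₜ[F] (s • d)) := by
      rw [htm, smul_smul, inv_mul_cancel₀ hs0, one_smul]
    rw [this]
    refine smul_mem_localOrder ?_ (tmul_mem_localOrder hsd)
    rw [map_inv₀, hvs, inv_one]
  simpa using add_mem hd h1

end Ramified

/-! ### Characters of the units of a ramified maximal order -/

section Characters

lemma le_exp_neg_one_of_lt_one {x : WithZero (Multiplicative ℤ)} (hx : x < 1) :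
    x ≤ WithZero.exp (-1 : ℤ) := by
  rw [← WithZero.lt_mul_exp_iff_le WithZero.exp_ne_zero, ← WithZero.exp_add]
  simpa using hx

/-- The `p ^ n`-th powers of a principal unit converge to `1`. -/
lemma valuation_pow_sub_one_le {A : Type*} [Ring A] (w : Valuation A (WithZero (Multiplicative ℤ)))
    {p : ℕ} (hp : p.Prime) (hwp : w (p : A) < 1) {u : A} (hu : w (u - 1) < 1) (n : ℕ) :
    w (u ^ p ^ n - 1) ≤ WithZero.exp (-1 : ℤ) ^ (n + 1) := by
  have hγ : WithZero.exp (-1 : ℤ) ≤ (1 : WithZero (Multiplicative ℤ)) := by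
    rw [← WithZero.exp_zero, WithZero.exp_le_exp]; norm_num
  induction n with
  | zero => simpa using le_exp_neg_one_of_lt_one hu
  | succ n ih =>
    set γ : WithZero (Multiplicative ℤ) := WithZero.exp (-1 : ℤ)
    have hz1 : w (u ^ p ^ n - 1) ≤ 1 := ih.trans (pow_le_one' hγ _)
    let z : w.integer := ⟨u ^ p ^ n - 1, hz1⟩
    -- In `(z + 1) ^ p = z ^ p + 1 + p z r` both terms other than `1` gain a factor `γ` over `z`:
    -- the first because `p ≥ 2`, the second because `w p ≤ γ`.
    obtain ⟨r, hr⟩ := (Commute.one_right z).exists_add_pow_prime_eq hp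
    have hr' : u ^ p ^ (n + 1) - 1 = (z : A) ^ p + (p : A) * z * r := by
      have := congrArg Subtype.val hr
      simp only [Subring.coe_add, Subring.coe_pow, Subring.coe_mul, Subring.coe_one,
        Subring.coe_natCast, one_pow, mul_one] at this
      rw [pow_succ, pow_mul, ← sub_add_cancel (u ^ p ^ n) 1]
      change ((z : A) + 1) ^ p - 1 = _
      rw [this]; abel
    rw [hr']
    refine (w.map_add _ _).trans (max_le ?_ ?_)
    · rw [map_pow]
      calc w (z : A) ^ p ≤ w (z : A) ^ 2 := pow_le_pow_right_of_le_one' z.2 hp.two_le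
        _ ≤ (γ ^ (n + 1)) ^ 2 := pow_le_pow_left' ih 2
        _ = γ ^ ((n + 1) * 2) := (pow_mul _ _ _).symm
        _ ≤ γ ^ (n + 1 + 1) := pow_le_pow_right_of_le_one' hγ (by omega)
    · rw [map_mul, map_mul, pow_succ']
      calc w (p : A) * w (z : A) * w (r : A) ≤ w (p : A) * w (z : A) := mul_le_of_le_one_right' r.2
        _ ≤ γ * γ ^ (n + 1) := mul_le_mul' (le_exp_neg_one_of_lt_one hwp) ih

variable {F : Type u} [Field F] [NumberField F] {D : Type u} [Ring D] [Algebra F D]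
  {v : HeightOneSpectrum (𝓞 F)}

lemma exists_generators {O : Subalgebra (𝓞 F) D} (hO : IsOrder F D O) : ∃ (n : ℕ) (e : Fin n → D),
    (∀ i, e i ∈ O) ∧ ∀ d ∈ O, ∃ c : Fin n → 𝓞 F, ∑ i, c i • e i = d := by
  obtain ⟨n, e, he⟩ := Submodule.fg_iff_exists_fin_generating_family.1 hO.1
  refine ⟨n, e, fun i => ?_, fun d hd => ?_⟩
  · have : e i ∈ Subalgebra.toSubmodule O := he ▸ Submodule.subset_span ⟨i, rfl⟩
    exact this
  · have : d ∈ Subalgebra.toSubmodule O := hd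
    rw [← he] at this
    exact (Submodule.mem_span_range_iff_exists_fun _).1 this

lemma tmul_smul_eq (r : 𝓞 F) (d : D) : (1 : v.adicCompletion F) ⊗ₜ[F] (r • d) =
    algebraMap F (v.adicCompletion F) (algebraMap (𝓞 F) F r) • (1 ⊗ₜ[F] d) := by
  rw [← algebraMap_smul F r d, TensorProduct.tmul_smul]
  exact (algebraMap_smul _ _ _).symm

/-- The completion of an order is spanned by generators of the order. -/
lemma exists_sum_of_mem_localOrder {O : Subalgebra (𝓞 F) D} {n : ℕ} {e : Fin n → D}
    (he : ∀ d ∈ O, ∃ c : Fin n → 𝓞 F, ∑ i, c i • e i = d) {x : LocalAlg F D v}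
    (hx : x ∈ localOrder O v) : ∃ c : Fin n → v.adicCompletion F, (∀ i, Valued.v (c i) ≤ 1) ∧
      ∑ i, c i • ((1 : v.adicCompletion F) ⊗ₜ[F] e i) = x := by
  -- The image of the order is already closed under multiplication, so the algebra it generates is
  -- just its span.
  have hcl : (Submonoid.closure ((fun d : D => (1 : v.adicCompletion F) ⊗ₜ[F] d) '' (O : Set D)) :
      Set (LocalAlg F D v)) = (fun d : D => (1 : v.adicCompletion F) ⊗ₜ[F] d) '' (O : Set D) := by
    exact congrArg _ (Submonoid.closure_eq (O.toSubmonoid.map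
      ((Algebra.TensorProduct.includeRight : D →ₐ[F] LocalAlg F D v) : D →* LocalAlg F D v)))
  have hx' : x ∈ Subalgebra.toSubmodule (localOrder O v) := hx
  rw [localOrder, Algebra.adjoin_eq_span, hcl] at hx'
  clear hx
  induction hx' using Submodule.span_induction with
  | mem x hx =>
    obtain ⟨d, hd, rfl⟩ := hx
    obtain ⟨c, rfl⟩ := he d hd
    refine ⟨fun i => algebraMap F _ (algebraMap (𝓞 F) F (c i)), fun i => ?_, ?_⟩
    · rw [valued_algebraMap_int]; exact v.intValuation_le_one _
    · simp only [TensorProduct.tmul_sum, tmul_smul_eq]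
  | zero => exact ⟨0, fun i => by simp, by simp⟩
  | add x y _ _ hx hy =>
    obtain ⟨c, hc, rfl⟩ := hx
    obtain ⟨c', hc', rfl⟩ := hy
    refine ⟨c + c', fun i => (Valuation.map_add _ _ _).trans (max_le (hc i) (hc' i)), ?_⟩
    simp only [Pi.add_apply, add_smul, Finset.sum_add_distrib]
  | smul r x _ hx =>
    obtain ⟨c, hc, rfl⟩ := hx
    refine ⟨fun i => r * c i, fun i => ?_, ?_⟩
    · rw [map_mul]; exact mul_le_one' r.2 (hc i)
    · rw [Finset.smul_sum]
      simp only [mul_smul]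
      rfl

lemma exists_intValuation_eq : ∃ r : 𝓞 F, v.intValuation r = WithZero.exp (-1 : ℤ) :=
  v.intValuation_exists_uniformizer

variable [Algebra.IsCentral F D] (h4 : Module.finrank F D = 4) (hv : IsRamifiedAt F D v)

lemma localVal_natCast_lt_one {p : ℕ} (hp : (p : 𝓞 F) ∈ v.asIdeal) :
    localVal D v h4 hv (p : LocalAlg F D v) < 1 := by
  have h1 : (p : LocalAlg F D v) = algebraMap (v.adicCompletion F) _
      (algebraMap F _ (algebraMap (𝓞 F) F p)) := by simp
  rw [h1, localVal_algebraMap, valued_algebraMap_int]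
  exact pow_lt_one₀ zero_le ((v.intValuation_lt_one_iff_mem _).2 hp) four_ne_zero

/-- The residue ring of `D_v` is finite. -/
lemma exists_finite_residue {O : Subalgebra (𝓞 F) D} (hO : Maximal (IsOrder F D) O) :
    ∃ T : Set (LocalAlg F D v), T.Finite ∧
      ∀ x, localVal D v h4 hv x ≤ 1 → ∃ t ∈ T, localVal D v h4 hv (x - t) < 1 := by
  obtain ⟨n, e, heO, he⟩ := exists_generators hO.1
  have : Finite (𝓞 F ⧸ v.asIdeal) := v.asIdeal.finiteQuotientOfFreeOfNeBot v.ne_bot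
  let lift : (𝓞 F ⧸ v.asIdeal) → v.adicCompletion F := fun c =>
    algebraMap F _ (algebraMap (𝓞 F) F (Quotient.out c))
  -- The representatives are the combinations of the generators of the order whose coefficients are
  -- lifts of elements of `𝓞 F ⧸ v`.
  refine ⟨Set.range fun c : Fin n → 𝓞 F ⧸ v.asIdeal =>
    ∑ i, lift (c i) • ((1 : v.adicCompletion F) ⊗ₜ[F] e i), Set.finite_range _, fun x hx => ?_⟩
  obtain ⟨c, hc, rfl⟩ := exists_sum_of_mem_localOrder he ((mem_localOrder_iff h4 hv hO).2 hx)
  have hlift : ∀ i, ∃ r, Valued.v (c i - lift r) < 1 := by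
    intro i
    obtain ⟨r, hr⟩ := exists_int_sub_lt_one v (c i) (hc i)
    refine ⟨Ideal.Quotient.mk _ r, ?_⟩
    rw [← sub_add_sub_cancel]
    refine Valuation.map_add_lt _ hr ?_
    rw [← map_sub, ← map_sub, valued_algebraMap_int, v.intValuation_lt_one_iff_mem,
      ← Ideal.Quotient.eq]
    exact (Quotient.out_eq (Ideal.Quotient.mk v.asIdeal r)).symm
  choose r hr using hlift
  refine ⟨_, ⟨r, rfl⟩, ?_⟩
  rw [← Finset.sum_sub_distrib]
  refine Valuation.map_sum_lt _ one_ne_zero fun i _ => ?_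
  rw [← sub_smul, localVal_smul]
  exact (mul_le_of_le_one_right' (localVal_tmul_le_one h4 hv hO.1 (heO i))).trans_lt
    (pow_lt_one₀ zero_le (hr i) four_ne_zero)

/-- Some inner automorphism of `D_v` induces the Frobenius automorphism of its residue field. -/
lemma exists_conj_frobenius {O : Subalgebra (𝓞 F) D} (hO : Maximal (IsOrder F D) O) {p : ℕ}
    [Fact p.Prime] (hp : (p : 𝓞 F) ∈ v.asIdeal) :
    ∃ a : (LocalAlg F D v)ˣ, ∀ x : LocalAlg F D v, localVal D v h4 hv x ≤ 1 →
      localVal D v h4 hv (a * x * (a⁻¹ : (LocalAlg F D v)ˣ) -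
        x ^ Nat.card (𝓞 F ⧸ v.asIdeal)) < 1 := by
  obtain ⟨T, hT, hwT⟩ := exists_finite_residue h4 hv hO
  obtain ⟨f, hf⟩ := exists_card_eq_pow v hp
  have hle : ∀ c : v.adicCompletion F, localVal D v h4 hv (algebraMap _ _ c) ≤ 1 ↔
      Valued.v c ≤ 1 := fun c => by
    rw [localVal_algebraMap]; exact pow_le_one_iff_of_nonneg zero_le four_ne_zero
  rw [hf]
  refine exists_conj_sub_pow_lt_one (K := v.adicCompletion F) hv localAlg_center _ T hT hwT ?_
    Fact.out (localVal_natCast_lt_one h4 hv hp) ?_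
  · intro x hx
    obtain ⟨t, n, ht, hn, h, -⟩ := exists_quadratic_of_normValuation_le_one hv
      (finrank_localAlg h4) localAlg_center Valued.v (exists_root_adicCompletion v) hx
    exact ⟨t, n, (hle t).2 ht, (hle n).2 hn, h⟩
  · intro c hc
    rw [← map_pow, ← map_sub, localVal_algebraMap, ← hf]
    exact pow_lt_one₀ zero_le (valued_pow_card_sub_lt_one v c ((hle c).1 hc)) four_ne_zero

instance : IsModuleTopology (v.adicCompletion F) (LocalAlg F D v) := ⟨rfl⟩

/-- The sets `1 + {w ≤ exp (-m)}` form a neighbourhood basis of `1` in `D_v`. -/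
lemma exists_forall_localVal_le_mem {O : Subalgebra (𝓞 F) D} (hO : Maximal (IsOrder F D) O)
    {W : Set (LocalAlg F D v)} (hW : W ∈ nhds 1) : ∃ m : ℕ, ∀ x : LocalAlg F D v,
      localVal D v h4 hv (x - 1) ≤ WithZero.exp (-1 : ℤ) ^ m → x ∈ W := by
  obtain ⟨n, e, heO, he⟩ := exists_generators hO.1
  have : ContinuousAdd (LocalAlg F D v) := IsModuleTopology.toContinuousAdd (v.adicCompletion F) _
  let φ : (Fin n → v.adicCompletion F) →ₗ[v.adicCompletion F] LocalAlg F D v :=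
    Fintype.linearCombination _ fun i => (1 : v.adicCompletion F) ⊗ₜ[F] e i
  have hφ : ∀ c, φ c = ∑ i, c i • ((1 : v.adicCompletion F) ⊗ₜ[F] e i) := fun c =>
    Fintype.linearCombination_apply _ _ _
  have hcont : Continuous fun c => 1 + φ c :=
    continuous_const.add (IsModuleTopology.continuous_of_linearMap φ)
  have hnhds : (fun c => 1 + φ c) ⁻¹' W ∈ nhds 0 :=
    hcont.continuousAt.preimage_mem_nhds (by simpa using hW)
  obtain ⟨ε, hε, hball⟩ := Metric.mem_nhds_iff.1 hnhds
  obtain ⟨π, hπ⟩ := exists_intValuation_eq (v := v)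
  set ϖ : v.adicCompletion F := algebraMap F _ (algebraMap (𝓞 F) F π) with hϖ
  have hvϖ : Valued.v ϖ = WithZero.exp (-1 : ℤ) := by rw [hϖ, valued_algebraMap_int, hπ]
  have hϖ0 : ϖ ≠ 0 := by
    intro h; rw [h, map_zero] at hvϖ; exact WithZero.exp_ne_zero hvϖ.symm
  have hϖ1 : ‖ϖ‖ < 1 := Valued.toNormedField.norm_lt_one_iff.2 (by
    rw [hvϖ, ← WithZero.exp_zero, WithZero.exp_lt_exp]; norm_num)
  obtain ⟨m, hm⟩ := exists_pow_lt_of_lt_one hε hϖ1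
  -- Since `w ϖ = exp (-1) ^ 4`, this bound says that `x - 1` is `ϖ ^ m` times an element of the
  -- local order. Its coordinates then have norm at most `‖ϖ‖ ^ m < ε`.
  refine ⟨m * 4, fun x hx => ?_⟩
  have hy : localVal D v h4 hv ((ϖ ^ m)⁻¹ • (x - 1)) ≤ 1 := by
    rw [localVal_smul, map_inv₀, map_pow, hvϖ, inv_pow, ← pow_mul]
    exact (mul_le_mul_right hx _).trans
      (inv_mul_cancel₀ (pow_ne_zero _ WithZero.exp_ne_zero)).le
  obtain ⟨c, hc, hcx⟩ := exists_sum_of_mem_localOrder he ((mem_localOrder_iff h4 hv hO).2 hy)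
  have hmem : ϖ ^ m • c ∈ Metric.ball (0 : Fin n → v.adicCompletion F) ε := by
    rw [mem_ball_zero_iff, pi_norm_lt_iff hε]
    intro i
    rw [Pi.smul_apply, norm_smul, norm_pow]
    exact (mul_le_of_le_one_right (by positivity)
      (Valued.toNormedField.norm_le_one_iff.2 (hc i))).trans_lt hm
  have := hball hmem
  rw [Set.mem_preimage, map_smul, hφ, hcx, smul_smul, mul_inv_cancel₀ (pow_ne_zero _ hϖ0),
    one_smul, add_sub_cancel] at this
  exact this

lemma mem_localOrderUnits_iff {O : Subalgebra (𝓞 F) D} (hO : Maximal (IsOrder F D) O)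
    {x : (LocalAlg F D v)ˣ} : x ∈ localOrderUnits O v ↔ localVal D v h4 hv x = 1 := by
  have hmul : localVal D v h4 hv x * localVal D v h4 hv (x⁻¹ : (LocalAlg F D v)ˣ) = 1 := by
    rw [← map_mul, Units.mul_inv, map_one]
  rw [localOrderUnits, Submonoid.mem_units_iff]
  change x.1 ∈ localOrder O v ∧ (x⁻¹).1 ∈ localOrder O v ↔ _
  rw [mem_localOrder_iff h4 hv hO, mem_localOrder_iff h4 hv hO]
  constructor
  · rintro ⟨h1, h2⟩
    refine le_antisymm h1 ?_
    rw [← hmul]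
    exact mul_le_of_le_one_right' h2
  · intro h
    rw [h, one_mul] at hmul
    exact ⟨h.le, hmul.le⟩

end Characters

/-! ### Tameness of weights, and their conjugates. -/

instance charP_Fbar (p : ℕ) [hp : Fact p.Prime] : CharP (Fbar p) p := by
  refine (CharP.charP_iff_prime_eq_zero hp.out).2 ?_
  rw [← map_natCast (IsLocalRing.residue (Coeff p)), IsLocalRing.residue_eq_zero_iff,
    Valuation.mem_maximalIdeal_iff]
  change Valued.v (p : PadicAlgCl p) < 1
  rw [PadicAlgCl.valuation_p, one_div]
  exact inv_lt_one_of_one_lt₀ (by exact_mod_cast hp.out.one_lt)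

lemma eq_one_of_pow_char_pow_eq_one {p : ℕ} [hp : Fact p.Prime] {x : (Fbar p)ˣ} {n : ℕ}
    (h : x ^ p ^ n = 1) : x = 1 := by
  have h1 : ((x : Fbar p) - 1) ^ p ^ n = 0 := by
    rw [sub_pow_char_pow, one_pow, ← Units.val_pow_eq_pow_val, h, Units.val_one, sub_self]
  ext
  exact sub_eq_zero.1 (pow_eq_zero_iff (pow_ne_zero _ hp.out.ne_zero) |>.1 h1)

namespace QuaternionDatum

variable {F : Type u} [Field F] [NumberField F] {p : ℕ} [hp : Fact p.Prime]
  (B : QuaternionDatum F p)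

/-- The valuation of `D_v` for `v ∣ p`. -/
def valAbove (v : PlacesAbove F p) : Valuation (LocalAlg F B.D v.1) (WithZero (Multiplicative ℤ)) :=
  localVal B.D v.1 B.finrank_eq (B.ramified_above v.1 v.2)

lemma mem_localOrder_iff_valAbove {v : PlacesAbove F p} {x : LocalAlg F B.D v.1} :
    x ∈ localOrder B.order v.1 ↔ B.valAbove v x ≤ 1 :=
  mem_localOrder_iff _ _ B.order_maximal

lemma mem_orderUnits_iff {v : PlacesAbove F p} {x : (LocalAlg F B.D v.1)ˣ} :
    x ∈ B.orderUnits v.1 ↔ B.valAbove v x = 1 :=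
  mem_localOrderUnits_iff _ _ B.order_maximal

lemma valAbove_conj {v : PlacesAbove F p} (a x : (LocalAlg F B.D v.1)ˣ) :
    B.valAbove v (a * x * a⁻¹ : (LocalAlg F B.D v.1)ˣ) = B.valAbove v x := by
  have h1 : B.valAbove v (a : LocalAlg F B.D v.1) *
      B.valAbove v ((a⁻¹ : (LocalAlg F B.D v.1)ˣ) : LocalAlg F B.D v.1) = 1 := by
    rw [← map_mul, Units.mul_inv, map_one]
  rw [Units.val_mul, Units.val_mul, map_mul, map_mul, mul_right_comm, h1, one_mul]

lemma conj_mem_orderUnits {v : PlacesAbove F p} (a : (LocalAlg F B.D v.1)ˣ)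
    {x : (LocalAlg F B.D v.1)ˣ} (hx : x ∈ B.orderUnits v.1) : a * x * a⁻¹ ∈ B.orderUnits v.1 := by
  rw [mem_orderUnits_iff] at hx ⊢
  rw [valAbove_conj, hx]

/-- A character of `𝓞_{D,v}ˣ` is tame if it is trivial on the principal units. -/
def IsTame {v : PlacesAbove F p} (χ : B.orderUnits v.1 →* (Fbar p)ˣ) : Prop :=
  ∀ u : B.orderUnits v.1, B.valAbove v (((u : (LocalAlg F B.D v.1)ˣ) : LocalAlg F B.D v.1) - 1) < 1 →
    χ u = 1

/-- For a principal unit `u`, the power `u ^ p ^ m` falls into the open subgroup `N` for large `m`,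
so `χ u` is killed by a power of `p`; in characteristic `p` only `1` has this property. -/
lemma isTame_of_isOpen {v : PlacesAbove F p} {χ : B.orderUnits v.1 →* (Fbar p)ˣ}
    {N : Subgroup (LocalAlg F B.D v.1)ˣ} (hN : IsOpen (N : Set (LocalAlg F B.D v.1)ˣ))
    (hχ : ∀ x : B.orderUnits v.1, (x : (LocalAlg F B.D v.1)ˣ) ∈ N → χ x = 1) :
    B.IsTame χ := by
  intro u hu
  have hN1 : (N : Set (LocalAlg F B.D v.1)ˣ) ∈ nhds 1 := hN.mem_nhds N.one_mem
  -- The topology on units is induced from pairs `(u, u⁻¹)`, so the powers of both `u` and its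
  -- inverse have to be close to `1`; the inverse is again a principal unit.
  rw [Units.isInducing_embedProduct.nhds_eq_comap, Filter.mem_comap] at hN1
  obtain ⟨t, ht, htN⟩ := hN1
  rw [map_one, ← Prod.mk_one_one, mem_nhds_prod_iff] at ht
  obtain ⟨W, hW, W', hW', hWW⟩ := ht
  have hW'' : MulOpposite.op ⁻¹' W' ∈ nhds (1 : LocalAlg F B.D v.1) :=
    MulOpposite.continuous_op.continuousAt.preimage_mem_nhds (by simpa using hW')
  obtain ⟨m, hm⟩ := exists_forall_localVal_le_mem B.finrank_eq (B.ramified_above v.1 v.2)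
    B.order_maximal (Filter.inter_mem hW hW'')
  have hγ : WithZero.exp (-1 : ℤ) ≤ (1 : WithZero (Multiplicative ℤ)) := by
    rw [← WithZero.exp_zero, WithZero.exp_le_exp]; norm_num
  have hpow : ∀ y : LocalAlg F B.D v.1, B.valAbove v (y - 1) < 1 →
      B.valAbove v (y ^ p ^ m - 1) ≤ WithZero.exp (-1 : ℤ) ^ m := fun y hy =>
    (valuation_pow_sub_one_le _ hp.out (localVal_natCast_lt_one _ _ v.2) hy m).trans
      (pow_le_pow_right_of_le_one' hγ (Nat.le_succ m))
  have hinv : B.valAbove v (((u : (LocalAlg F B.D v.1)ˣ)⁻¹ : (LocalAlg F B.D v.1)ˣ) - 1) < 1 := by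
    have h1 : (((u : (LocalAlg F B.D v.1)ˣ)⁻¹ : (LocalAlg F B.D v.1)ˣ) : LocalAlg F B.D v.1) - 1 =
        ((u : (LocalAlg F B.D v.1)ˣ)⁻¹ : (LocalAlg F B.D v.1)ˣ) *
          (1 - (u : (LocalAlg F B.D v.1)ˣ)) := by
      rw [mul_sub, mul_one, Units.inv_mul]
    rw [h1, map_mul, B.mem_orderUnits_iff.1 (inv_mem u.2), one_mul, Valuation.map_sub_swap]
    exact hu
  have hmem : ((u : (LocalAlg F B.D v.1)ˣ) ^ p ^ m) ∈ N := by
    refine htN (hWW ⟨(hm _ ?_).1, ?_⟩)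
    · rw [Units.embedProduct_apply, Units.val_pow_eq_pow_val]
      exact hpow _ hu
    · have := (hm ((((u : (LocalAlg F B.D v.1)ˣ) ^ p ^ m)⁻¹ : (LocalAlg F B.D v.1)ˣ)) (by
        rw [← inv_pow, Units.val_pow_eq_pow_val]; exact hpow _ hinv)).2
      exact this
  refine eq_one_of_pow_char_pow_eq_one (n := m) ?_
  rw [← map_pow]
  exact hχ _ hmem

lemma isTame_of_isWeight {σ : B.WeightChar} (hσ : B.IsWeight σ) (v : PlacesAbove F p) :
    B.IsTame (σ v) := by
  obtain ⟨N, hN, h⟩ := hσ v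
  exact B.isTame_of_isOpen hN h

/-- When conjugation by `a` induces Frobenius on residues, `a x a⁻¹` and `x ^ q` differ by a
principal unit, which a tame character does not see. -/
lemma exists_conj_char_eq_pow {v : PlacesAbove F p} {χ : B.orderUnits v.1 →* (Fbar p)ˣ}
    (hχ : B.IsTame χ) : ∃ a : (LocalAlg F B.D v.1)ˣ, ∀ x : B.orderUnits v.1,
      χ ⟨a * x * a⁻¹, B.conj_mem_orderUnits a x.2⟩ = χ x ^ Nat.card (𝓞 F ⧸ v.1.asIdeal) := by
  obtain ⟨a, ha⟩ := exists_conj_frobenius B.finrank_eq (B.ramified_above v.1 v.2)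
    B.order_maximal v.2
  refine ⟨a, fun x => ?_⟩
  set q := Nat.card (𝓞 F ⧸ v.1.asIdeal)
  rw [← map_pow, ← inv_mul_eq_one, ← map_inv, ← map_mul]
  refine hχ _ ?_
  set z : (LocalAlg F B.D v.1)ˣ := a * x * a⁻¹ with hz
  have hz1 : z ∈ B.orderUnits v.1 := B.conj_mem_orderUnits a x.2
  change B.valAbove v ((z⁻¹ : (LocalAlg F B.D v.1)ˣ) *
    (((x : (LocalAlg F B.D v.1)ˣ) ^ q : (LocalAlg F B.D v.1)ˣ) : LocalAlg F B.D v.1) - 1) < 1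
  rw [← Units.inv_mul z, ← mul_sub, map_mul, B.mem_orderUnits_iff.1 (inv_mem hz1), one_mul,
    Valuation.map_sub_swap, Units.val_pow_eq_pow_val]
  exact ha _ (B.mem_orderUnits_iff.1 x.2).le

end QuaternionDatum

/-! ### Weights given by characters of the residue fields `k_{2,v}`. -/

namespace ResidueIdent

variable {F : Type u} [Field F] [NumberField F] {p : ℕ} [hp : Fact p.Prime]
  {B : QuaternionDatum F p} {k₂ : PlacesAbove F p → Type u} [∀ v, Field (k₂ v)]
  [∀ v, Algebra (𝓞 F ⧸ v.1.asIdeal) (k₂ v)] (ι : ResidueIdent B k₂)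
  (τ : ∀ v, (k₂ v)ˣ →* (Fbar p)ˣ)

/-- If `w x < 1` then `w (x ^ 4) ≤ exp (-1) ^ 4 = w ϖ`, so `x ^ 4` is a multiple of `ϖ` in the local
order. The reduction kills `π` by its compatibility with `k_v`, and its target is a field. -/
lemma red_eq_zero {v : PlacesAbove F p} {x : localOrder B.order v.1}
    (hx : B.valAbove v x < 1) : ι.red v x = 0 := by
  obtain ⟨π, hπ⟩ := exists_intValuation_eq (v := v.1)
  set ϖ : v.1.adicCompletion F := algebraMap F _ (algebraMap (𝓞 F) F π) with hϖ
  have hvϖ : Valued.v ϖ = WithZero.exp (-1 : ℤ) := by rw [hϖ, valued_algebraMap_int, hπ]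
  have hϖ0 : ϖ ≠ 0 := by
    intro h; rw [h, map_zero] at hvϖ; exact WithZero.exp_ne_zero hvϖ.symm
  have hy : ϖ⁻¹ • (x : LocalAlg F B.D v.1) ^ 4 ∈ localOrder B.order v.1 := by
    rw [B.mem_localOrder_iff_valAbove, QuaternionDatum.valAbove, localVal_smul, map_inv₀, hvϖ,
      map_pow, inv_pow]
    refine (mul_le_mul_right (pow_le_pow_left' (le_exp_neg_one_of_lt_one hx) 4) _).trans ?_
    exact (inv_mul_cancel₀ (pow_ne_zero _ WithZero.exp_ne_zero)).le
  have hx4 : x ^ 4 = algebraMap (v.1.adicCompletionIntegers F) _ (algebraMap (𝓞 F) _ π) *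
      ⟨_, hy⟩ := by
    ext
    change (x : LocalAlg F B.D v.1) ^ 4 = algebraMap (v.1.adicCompletion F) _ ϖ *
      (ϖ⁻¹ • (x : LocalAlg F B.D v.1) ^ 4)
    rw [← Algebra.smul_def, smul_smul, mul_inv_cancel₀ hϖ0, one_smul]
  have hπv : π ∈ v.1.asIdeal := by
    rw [← v.1.intValuation_lt_one_iff_mem, hπ, ← WithZero.exp_zero, WithZero.exp_lt_exp]
    norm_num
  have h4 : ι.red v x ^ 4 = 0 := by
    rw [← map_pow, hx4, map_mul, ι.red_algebraMap, Ideal.Quotient.eq_zero_iff_mem.2 hπv, map_zero,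
      zero_mul]
  exact pow_eq_zero_iff four_ne_zero |>.1 h4

lemma isTame_pullback (v : PlacesAbove F p) : B.IsTame (ι.pullback τ v) := by
  intro u hu
  let u' := Submonoid.unitsEquivUnitsType (localOrder B.order v.1).toSubmonoid u
  change τ v (Units.map (ι.red v : localOrder B.order v.1 →* k₂ v) u') = 1
  have h : ι.red v ((show localOrder B.order v.1 from u'.1) - 1) = 0 := ι.red_eq_zero hu
  rw [map_sub, map_one, sub_eq_zero] at h
  have : Units.map (ι.red v : localOrder B.order v.1 →* k₂ v) u' = 1 := Units.ext h
  rw [this, map_one]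

/-- Raising a character to a power commutes with composition with the reduction map. Hence the
statement for varying `D` reduces to each `D` separately, and identifications for different `D`
never have to be compared. -/
lemma pullback_frobTwist (v : PlacesAbove F p) :
    ι.pullback (frobTwist v τ) = frobTwist v (ι.pullback τ) := by
  funext w
  by_cases h : w = v
  · subst h
    ext x
    simp only [pullback, frobTwist, Function.update_self]
    rfl
  · simp [pullback, frobTwist, h]

end ResidueIdent

namespace QuaternionDatum

variable {F : Type u} [Field F] [NumberField F] {p : ℕ} [hp : Fact p.Prime]

/-! ### Translation by an element at a place above `p` -/

namespace Level

variable {B : QuaternionDatum F p} (L : B.Level)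

/-- At `v` the level is the full group `𝓞_{D,v}ˣ`, which every element of `D_vˣ` normalises since
conjugation preserves the valuation; the other components do not change. -/
lemma conj_localIncl_mem {v : PlacesAbove F p} (a : (LocalAlg F B.D v.1)ˣ) {u : B.G}
    (hu : u ∈ L.U) : localIncl F B.D v.1 a * u * (localIncl F B.D v.1 a)⁻¹ ∈ L.U := by
  rw [mem_U] at hu ⊢
  intro w
  rw [map_mul, map_mul, map_inv]
  by_cases h : w = v.1
  · subst h
    rw [unitComp_localIncl_same]
    have h1 := L.loc_eq v.1 (B.ramified_above v.1 v.2)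
    have h2 := hu v.1
    rw [h1] at h2 ⊢
    exact B.conj_mem_orderUnits a h2
  · rw [unitComp_localIncl_ne h, one_mul, inv_one, mul_one]
    exact hu w

/-- The weight `σ'` is obtained from `σ` by conjugation by an element of `D_vˣ`. -/
def IsConj (σ σ' : B.WeightChar) (v : PlacesAbove F p) (a : (LocalAlg F B.D v.1)ˣ) : Prop :=
  (∀ w, w ≠ v → σ' w = σ w) ∧
    ∀ x : B.orderUnits v.1, σ' v x = σ v ⟨a * x * a⁻¹, B.conj_mem_orderUnits a x.2⟩

/-- By this symmetry, modularity has to be transferred in one direction only. -/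
lemma IsConj.symm {σ σ' : B.WeightChar} {v : PlacesAbove F p} {a : (LocalAlg F B.D v.1)ˣ}
    (h : IsConj σ σ' v a) : IsConj σ' σ v a⁻¹ := by
  refine ⟨fun w hw => (h.1 w hw).symm, fun x => ?_⟩
  rw [h.2]
  congr 1
  ext1
  simp [mul_assoc]

/-- The localisation is nonzero exactly when some form is killed by no element outside `m`. In this
shape the condition passes along any injective Hecke-equivariant map. -/
lemma inSupport_iff {σ : B.WeightChar} {ψ : (FiniteAdeleRing (𝓞 F) F)ˣ →* (Coeff p)ˣ}
    {m : Ideal L.HeckeAlg} [m.IsPrime] : L.InSupport σ ψ m ↔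
      ∃ f : L.forms σ ψ, ∀ r ∈ m.primeCompl, L.heckeAction σ ψ r f ≠ 0 := by
  let : Module L.HeckeAlg (L.forms σ ψ) :=
    Module.compHom (L.forms σ ψ) (L.heckeAction σ ψ).toRingHom
  change Nontrivial (LocalizedModule m.primeCompl (L.forms σ ψ)) ↔ _
  rw [← not_subsingleton_iff_nontrivial, LocalizedModule.subsingleton_iff]
  push Not
  rfl

variable {L} {σ σ' : B.WeightChar} {v : PlacesAbove F p} {a : (LocalAlg F B.D v.1)ˣ}
  (h : IsConj σ σ' v a)
include h

lemma IsConj.char_eq (u : L.U) : L.char σ' u =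
    L.char σ ⟨localIncl F B.D v.1 a * u * (localIncl F B.D v.1 a)⁻¹,
      L.conj_localIncl_mem a u.2⟩ := by
  rw [char, char, MonoidHom.finsetProd_apply, MonoidHom.finsetProd_apply]
  refine Finset.prod_congr rfl fun w _ => ?_
  rw [MonoidHom.comp_apply, MonoidHom.comp_apply]
  by_cases hw : w = v
  · subst hw
    rw [h.2]
    congr 1
    ext1
    change a * unitComp F B.D w.1 u * a⁻¹ = unitComp F B.D w.1
      (localIncl F B.D w.1 a * u * (localIncl F B.D w.1 a)⁻¹)
    rw [map_mul, map_mul, map_inv, unitComp_localIncl_same]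
  · rw [h.1 w hw]
    congr 1
    ext1
    change unitComp F B.D w.1 u = unitComp F B.D w.1
      (localIncl F B.D v.1 a * u * (localIncl F B.D v.1 a)⁻¹)
    rw [map_mul, map_mul, map_inv, unitComp_localIncl_ne (fun e => hw (Subtype.ext e)), one_mul,
      inv_one, mul_one]

/-- Conjugation by `a` fixes scalars, so `σ` and `σ'` have the same restriction to the centre and
the same `ψ` serves both. -/
lemma IsConj.isCentralChar {ψ : (FiniteAdeleRing (𝓞 F) F)ˣ →* (Coeff p)ˣ}
    (hψ : L.IsCentralChar σ ψ) : L.IsCentralChar σ' ψ := by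
  refine ⟨hψ.1, hψ.2.1, fun w b hb => ?_⟩
  rw [← hψ.2.2 w b hb, h.char_eq]
  congr 1
  ext1
  rw [mul_inv_eq_iff_eq_mul]
  refine (localIncl_commute ?_).symm
  by_cases hw : w = v.1
  · subst hw
    rw [unitComp_localIncl_same]
    ext
    exact Algebra.commutes _ _
  · change unitComp F B.D v.1 (localIncl F B.D w _) * a = a * unitComp F B.D v.1 (localIncl F B.D w _)
    rw [unitComp_localIncl_ne (fun e => hw e.symm), one_mul, mul_one]

/-- Right translation by an element of `D_vˣ`, as a map between spaces of forms of conjugate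
weights. -/
def IsConj.translate (ψ : (FiniteAdeleRing (𝓞 F) F)ˣ →* (Coeff p)ˣ) :
    L.forms σ ψ →ₗ[Coeff p] L.forms σ' ψ where
  toFun f := ⟨fun g => f.1 (g * (localIncl F B.D v.1 a)⁻¹), by
    refine ⟨f.2.1.comp_continuous (continuous_mul_const _), fun d g => ?_, fun g u => ?_,
      fun g z => ?_⟩
    · change f.1 (globalIncl F B.D d * g * (localIncl F B.D v.1 a)⁻¹) = _
      rw [mul_assoc, f.2.2.1]
    -- This is `g u a⁻¹ = (g a⁻¹) (a u a⁻¹)`, where `a u a⁻¹` is again in `U`.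
    · rw [h.char_eq, ← f.2.2.2.1]
      group
    · have hz : Commute (ideleIncl F B.D z) (localIncl F B.D v.1 a)⁻¹ :=
        Units.ext (Algebra.commutes _ _)
      change f.1 (g * ideleIncl F B.D z * (localIncl F B.D v.1 a)⁻¹) = _
      rw [← f.2.2.2.2, mul_assoc, hz.eq, mul_assoc]⟩
  map_add' _ _ := rfl
  map_smul' _ _ := rfl

lemma IsConj.translate_apply (ψ : (FiniteAdeleRing (𝓞 F) F)ˣ →* (Coeff p)ˣ) (f : L.forms σ ψ)
    (g : B.G) : (h.translate ψ f).1 g = f.1 (g * (localIncl F B.D v.1 a)⁻¹) := rfl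

lemma IsConj.translate_injective (ψ : (FiniteAdeleRing (𝓞 F) F)ˣ →* (Coeff p)ˣ) :
    Function.Injective (h.translate (L := L) ψ) := by
  intro f f' hff
  ext g
  have := congrFun (congrArg Subtype.val hff) (g * localIncl F B.D v.1 a)
  rw [h.translate_apply, h.translate_apply, mul_inv_cancel_right] at this
  exact this

/-- The Hecke operator sums over right translates by elements of `D_w` with `w ≠ v`, and these
commute with `a`. -/
lemma IsConj.hecke_translate {ψ : (FiniteAdeleRing (𝓞 F) F)ˣ →* (Coeff p)ˣ}
    {w : HeightOneSpectrum (𝓞 F)} (hw : (p : 𝓞 F) ∉ w.asIdeal) (k : (LocalAlg F B.D w)ˣ)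
    (f : L.forms σ ψ) : hecke hw k (h.translate ψ f) = h.translate ψ (hecke hw k f) := by
  have hwv : v.1 ≠ w := fun e => hw (e ▸ v.2)
  ext g
  rw [hecke_apply, h.translate_apply, hecke_apply]
  refine Finset.sum_congr rfl fun c _ => ?_
  induction c using QuotientGroup.induction_on with | H x =>
  have hcomm : Commute (localIncl F B.D w x) (localIncl F B.D v.1 a) :=
    localIncl_commute (by rw [unitComp_localIncl_ne hwv, one_mul, mul_one])
  rw [cosetEval_mk, cosetEval_mk, h.translate_apply, mul_assoc, mul_assoc, hcomm.inv_right.eq]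

lemma IsConj.heckeAction_translate {ψ : (FiniteAdeleRing (𝓞 F) F)ˣ →* (Coeff p)ˣ}
    (t : L.HeckeAlg) (f : L.forms σ ψ) :
    L.heckeAction σ' ψ t (h.translate ψ f) = h.translate ψ (L.heckeAction σ ψ t f) := by
  induction t using MvPolynomial.induction_on generalizing f with
  | C c =>
    rw [← MvPolynomial.algebraMap_eq, AlgHom.commutes, AlgHom.commutes, Module.algebraMap_end_apply,
      Module.algebraMap_end_apply, map_smul]
  | add s t hs ht =>
    rw [map_add, map_add, LinearMap.add_apply, LinearMap.add_apply, hs, ht, map_add]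
  | mul_X t s ht =>
    rw [map_mul, map_mul, Module.End.mul_apply, Module.End.mul_apply, heckeAction_X, heckeAction_X]
    rw [← ht]
    congr 1
    cases s with
    | T w hw => exact h.hecke_translate _ _ f
    | S w hw => exact h.hecke_translate _ _ f

lemma IsConj.inSupport {ψ : (FiniteAdeleRing (𝓞 F) F)ˣ →* (Coeff p)ˣ} {m : Ideal L.HeckeAlg}
    [m.IsPrime] (hm : L.InSupport σ ψ m) : L.InSupport σ' ψ m := by
  rw [inSupport_iff] at hm ⊢
  obtain ⟨f, hf⟩ := hm
  refine ⟨h.translate ψ f, fun r hr H => hf r hr (h.translate_injective ψ ?_)⟩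
  rw [map_zero, ← h.heckeAction_translate, H]

end Level

/-! ### Transfer of modularity between conjugate weights. -/

variable {B : QuaternionDatum F p} {σ σ' : B.WeightChar} {v : PlacesAbove F p}

/-- The level, `ψ`, `m` and `θ` are all kept, so the condition that ties `ρ` to `θ` is literally the
same. -/
lemma Level.IsConj.isModularOfWeight {a : (LocalAlg F B.D v.1)ˣ} (h : Level.IsConj σ σ' v a)
    {ρ : GalF F →* GL (Fin 2) (Fbar p)} (hρ : B.IsModularOfWeight ρ σ) :
    B.IsModularOfWeight ρ σ' := by
  obtain ⟨L, ψ, hψ, m, hm, θ, hθ, hsupp, hass⟩ := hρ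
  exact ⟨L, ψ, h.isCentralChar hψ, m, hm, θ, hθ, h.inSupport hsupp, hass⟩

/-- For a tame weight, modularity is invariant under the Frobenius twist at `v`. -/
lemma isModularOfWeight_frobTwist_iff (hσ : B.IsTame (σ v))
    (ρ : GalF F →* GL (Fin 2) (Fbar p)) :
    B.IsModularOfWeight ρ σ ↔ B.IsModularOfWeight ρ (frobTwist v σ) := by
  obtain ⟨a, ha⟩ := B.exists_conj_char_eq_pow hσ
  have h : Level.IsConj σ (frobTwist v σ) v a := by
    refine ⟨fun w hw => Function.update_of_ne hw _ _, fun x => ?_⟩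
    rw [ha, frobTwist, Function.update_self]
    rfl
  exact ⟨h.isModularOfWeight, h.symm.isModularOfWeight⟩

end QuaternionDatum

end SerreWeight

end

theorem lemma2p2 {F : Type u} [Field F] [NumberField F] [IsTotallyReal F]
    (p : ℕ) [Fact p.Prime] (_hp : p ≠ 2)
    (ρ : SerreWeight.GalF F →* GL (Fin 2) (SerreWeight.Fbar p))
    (_hρ : IsOpen (ρ.ker : Set (SerreWeight.GalF F)))
    (v : SerreWeight.PlacesAbove F p) :
    -- weights as characters of the groups `𝓞_{D,v}ˣ`, for each fixed `D`
    (∀ (B : SerreWeight.QuaternionDatum F p) (σ : B.WeightChar), B.IsWeight σ →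
      (B.IsModularOfWeight ρ σ ↔ B.IsModularOfWeight ρ (SerreWeight.frobTwist v σ))) ∧
    -- weights as characters of the groups `k_{2,v}ˣ`, for varying `D`
    (∀ (k₂ : SerreWeight.PlacesAbove F p → Type u) [∀ w, Field (k₂ w)]
      [∀ w, Algebra (𝓞 F ⧸ w.1.asIdeal) (k₂ w)],
      (∀ w, Module.finrank (𝓞 F ⧸ w.1.asIdeal) (k₂ w) = 2) →
      ∀ (ι : ∀ B : SerreWeight.QuaternionDatum F p, SerreWeight.ResidueIdent B k₂)
        (τ : ∀ w, (k₂ w)ˣ →* (SerreWeight.Fbar p)ˣ),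
        SerreWeight.IsModularOfWeight ι ρ τ ↔
          SerreWeight.IsModularOfWeight ι ρ (SerreWeight.frobTwist v τ)) := by
  refine ⟨fun B σ hσ => ?_, fun k₂ _ _ _ ι τ => ?_⟩
  · exact SerreWeight.QuaternionDatum.isModularOfWeight_frobTwist_iff
      (B.isTame_of_isWeight hσ v) ρ
  · refine exists_congr fun B => ?_
    rw [(ι B).pullback_frobTwist τ v]
    exact SerreWeight.QuaternionDatum.isModularOfWeight_frobTwist_iff
      ((ι B).isTame_pullback τ v) ρ
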